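/- **Theorem D.1.** Fully-dynamic metric minimum Steiner tree: in a metric space $(V,d)$ with at least two points, let $D=\sup_{x\neq y}d(x,y)\,/\inf_{x\ne y}d(x,y)$ and assume $D<\infty$ (that is, the supremum is finite and the infimum is positive). Starting from the empty set of active terminals, at each time $t$ either an inactive vertex arrives or an active vertex departs; after each request an algorithm must hold a tree $S_t$ (a set of edges) that spans the active set $A_t$ and may use further (Steiner) vertices. Its cost is the sum of the lengths $d(x,y)$ of its edges, and its recourse at time $t$ is $|S_t\,\triangle\,S_{t-1}|$, with $S_0=\emptyset$. There is a deterministic online algorithm for this problem that is $O(1)$-competitive and has amortized recourse $O(1+\log D)$: for absolute constants $\kappa,K$, for every request sequence and every $t$, the cost of $S_t$ is at most $\kappa$ times the cost of every Steiner tree for $A_t$, and $\sum_{i\le t}|S_i\triangle S_{i-1}|\le K(1+\log D)\,t$. More precisely, this holds for the following local search with $\gamma=e^2$, which terminates after each request, however its choices are made by a deterministic rule. It keeps a set $L$ of live vertices (the active terminals and the Steiner vertices in use) and a permutation $\pi$ of the edges between live vertices, both initially empty. Let $f(S)=|L|$ minus the number of connected components that the edge set $S$ induces on $L$, let the coverage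 of $e$ be its marginal value for $f$ given the edges before it in $\pi$, and let $\mathfrak F_\pi(e)$ be its coverage divided by its length. The current solution is the set of edges of positive coverage. If a vertex that is not live arrives, it becomes live and its edges to the other live vertices are appended to $\pi$ in any order; an arriving vertex that is live as a Steiner vertex just becomes active; a departing vertex becomes a Steiner vertex and stays live. Then, as long as possible: if some Steiner vertex has degree at most $2$ in the current solution, such a vertex $v$ is deleted from $L$ with all its edges, where for degree $2$ the edge between its two neighbours in the solution is first moved to the position in $\pi$ of one of the two solution edges at $v$; otherwise a local move is made, namely either a swap of two adjacent edges of $\pi$ of which the second has the strictly larger $\mathfrak F_\pi$, or a $\gamma$-move, which takes an edge $u$ ahead of a nonempty block of edges directly before it, giving $\pi'$, where $\mathfrak F_{\pi'}(u)>0$ and $\mathfrak F_{\pi'}(u)\ge\gamma\,\mathfrak F_\pi(b)$ for each $b$ in the block. When nothing is possible, the current solution is output as $S_t$. -/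

import Mathlib

/-! # Fully-dynamic metric minimum Steiner tree -/

namespace DynSteiner

/-! ## The dynamic problem and performance measures of a deterministic online algorithm -/

/-- An update of the set of active vertices (terminals). -/
inductive Request (V : Type*) where
  | arrive (v : V) : Request V
  | depart (v : V) : Request V

open scoped Classical in
/-- The terminals that are active after a history of requests. A history is a list of requests
with the most recent request at its head. -/
noncomputable def activeSet {V : Type*} : List (Request V) → Finset V
  | [] => ∅
  | Request.arrive v :: σ => insert v (activeSet σ)
  | Request.depart v :: σ => (activeSet σ).erase v

/-- Only inactive vertices arrive and only active vertices depart. -/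
def Legal {V : Type*} : List (Request V) → Prop
  | [] => True
  | Request.arrive v :: σ => Legal σ ∧ v ∉ activeSet σ
  | Request.depart v :: σ => Legal σ ∧ v ∈ activeSet σ

/-- The cost of an edge is the distance of its end points. -/
noncomputable def edgeCost {V : Type*} [MetricSpace V] (e : Sym2 V) : ℝ :=
  Sym2.lift ⟨fun x y => dist x y, fun x y => dist_comm x y⟩ e

/-- The total cost of a finite set of edges. -/
noncomputable def cost {V : Type*} [MetricSpace V] (E : Finset (Sym2 V)) : ℝ :=
  ∑ e ∈ E, edgeCost e

/-- The edge set `E` is a tree that spans the terminals `A`, possibly using further (Steiner)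
vertices: it has no loops and no cycles, and all terminals and all end points of edges lie in one
connected component. For at most one terminal the empty edge set is allowed. -/
def IsSteinerTree {V : Type*} (A : Finset V) (E : Finset (Sym2 V)) : Prop :=
  (∀ e ∈ E, ¬ e.IsDiag) ∧
  (SimpleGraph.fromEdgeSet (E : Set (Sym2 V))).IsAcyclic ∧
  ∀ x y : V, (x ∈ A ∨ ∃ e ∈ E, x ∈ e) → (y ∈ A ∨ ∃ e ∈ E, y ∈ e) →
    (SimpleGraph.fromEdgeSet (E : Set (Sym2 V))).Reachable x y

/-- A deterministic online algorithm: its solution (a set of edges) at any time is a function of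
the requests seen so far. -/
abbrev OnlineAlgorithm (V : Type*) := List (Request V) → Finset (Sym2 V)

/-- The algorithm always holds a tree spanning the currently active terminals. -/
def IsFeasible {V : Type*} (alg : OnlineAlgorithm V) : Prop :=
  ∀ σ, Legal σ → IsSteinerTree (activeSet σ) (alg σ)

/-- At any time the cost is at most `κ` times the cost of any, hence of an optimal, Steiner tree
for the currently active terminals. -/
def IsCompetitive {V : Type*} [MetricSpace V] (κ : ℝ) (alg : OnlineAlgorithm V) : Prop :=
  ∀ σ, Legal σ → ∀ E, IsSteinerTree (activeSet σ) E → cost (alg σ) ≤ κ * cost E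

open scoped Classical in
/-- The total number of edges inserted into or deleted from the solution over a history. -/
noncomputable def totalRecourse {V : Type*} (alg : OnlineAlgorithm V) : List (Request V) → ℕ
  | [] => (alg []).card
  | r :: σ => totalRecourse alg σ + (symmDiff (alg (r :: σ)) (alg σ)).card

/-- Amortized recourse at most `R` per request. -/
def HasAmortizedRecourse {V : Type*} (R : ℝ) (alg : OnlineAlgorithm V) : Prop :=
  ∀ σ, Legal σ → (totalRecourse alg σ : ℝ) ≤ R * (σ.length : ℝ)

/-- The distances of pairs of distinct points. -/
def distances (V : Type*) [MetricSpace V] : Set ℝ :=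
  {d | ∃ x y : V, x ≠ y ∧ d = dist x y}

/-! ## The local search -/

/-- The state of the local search: the active terminals, the live vertices (the active terminals
and the Steiner vertices in use), and a permutation of the edges between live vertices. -/
structure State (V : Type*) where
  active : Finset V
  live : Finset V
  perm : List (Sym2 V)

/-- The rank function of the graphic matroid on the live vertices: the number of live vertices
minus the number of connected components that the edges `S` induce on them. -/
noncomputable def rankFn {V : Type*} (L : Finset V) (S : Set (Sym2 V)) : ℝ :=
  (L.card : ℝ) -
    (Nat.card ((SimpleGraph.fromEdgeSet S).induce (L : Set V)).ConnectedComponent : ℝ)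

open scoped Classical in
/-- The set of edges that precede `e` in the permutation `π`. -/
def preceding {V : Type*} (π : List (Sym2 V)) (e : Sym2 V) : Set (Sym2 V) :=
  {x | x ∈ π.takeWhile (fun y => y ≠ e)}

/-- The marginal coverage of `e`, given the edges that precede it, per unit of cost. -/
noncomputable def density {V : Type*} [MetricSpace V] (L : Finset V) (π : List (Sym2 V))
    (e : Sym2 V) : ℝ :=
  (rankFn L (insert e (preceding π e)) - rankFn L (preceding π e)) / edgeCost e

open scoped Classical in
/-- The current solution: the edges with positive coverage. -/
noncomputable def State.tree {V : Type*} [MetricSpace V] (s : State V) : Finset (Sym2 V) :=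
  s.perm.toFinset.filter (fun e => 0 < density s.live s.perm e)

open scoped Classical in
/-- The degree of a vertex in the current solution. -/
noncomputable def State.degree {V : Type*} [MetricSpace V] (s : State V) (v : V) : ℕ :=
  (s.tree.filter (fun e => v ∈ e)).card

/-- The local search moves. A swap exchanges two adjacent edges if the second has the larger
density. A `γ`-move takes an edge `u` with positive coverage after the move ahead of a nonempty
block `B` of edges, if the density of `u` after the move is at least `γ` times the density before
the move of every edge in `B`. -/
inductive LocalMove {V : Type*} [MetricSpace V] (γ : ℝ) : State V → State V → Prop
  | swap (A L : Finset V) (X Y : List (Sym2 V)) (e u : Sym2 V)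
      (h : density L (X ++ e :: u :: Y) e < density L (X ++ e :: u :: Y) u) :
      LocalMove γ ⟨A, L, X ++ e :: u :: Y⟩ ⟨A, L, X ++ u :: e :: Y⟩
  | gammaMove (A L : Finset V) (X B Y : List (Sym2 V)) (u : Sym2 V) (hB : B ≠ [])
      (hpos : 0 < density L (X ++ u :: (B ++ Y)) u)
      (h : ∀ b ∈ B, γ * density L (X ++ (B ++ u :: Y)) b ≤ density L (X ++ u :: (B ++ Y)) u) :
      LocalMove γ ⟨A, L, X ++ (B ++ u :: Y)⟩ ⟨A, L, X ++ u :: (B ++ Y)⟩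

open scoped Classical in
/-- Cleaning a Steiner vertex (a live vertex that is not active) of degree at most two.
If its degree is at most one, it is deleted with all its edges. If its degree is two, it is
shortcut: the edge between its two neighbours moves to the position of one of the two tree edges
at the vertex, and the vertex is deleted with all its edges. -/
inductive CleanStep {V : Type*} [MetricSpace V] : State V → State V → Prop
  | delete (s : State V) (v : V) (hv : v ∈ s.live) (hv' : v ∉ s.active) (hd : s.degree v ≤ 1) :
      CleanStep s ⟨s.active, s.live.erase v, s.perm.filter (fun e => v ∉ e)⟩
  | shortcut (A L : Finset V) (X Y : List (Sym2 V)) (v u₁ u₂ : V) (hv : v ∈ L) (hv' : v ∉ A)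
      (hu : u₁ ≠ u₂) (hd : (State.mk A L (X ++ s(v, u₁) :: Y)).degree v = 2)
      (h₁ : s(v, u₁) ∈ (State.mk A L (X ++ s(v, u₁) :: Y)).tree)
      (h₂ : s(v, u₂) ∈ (State.mk A L (X ++ s(v, u₁) :: Y)).tree) :
      CleanStep ⟨A, L, X ++ s(v, u₁) :: Y⟩
        ⟨A, L.erase v, X.filter (fun e => v ∉ e ∧ e ≠ s(u₁, u₂)) ++
          s(u₁, u₂) :: Y.filter (fun e => v ∉ e ∧ e ≠ s(u₁, u₂))⟩

/-- One step of the loop: clean a Steiner vertex, or, if there is none to be cleaned, perform a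
local search move. -/
def Step {V : Type*} [MetricSpace V] (γ : ℝ) (s s' : State V) : Prop :=
  CleanStep s s' ∨ ((¬ ∃ s₁, CleanStep s s₁) ∧ LocalMove γ s s')

open scoped Classical in
/-- Reading a request. If `v` arrives and is not live, the edges between `v` and the live vertices
are appended to the permutation in arbitrary order; if `v` arrives and is live (as a Steiner
vertex), it only becomes active. If `v` departs, it becomes a Steiner vertex and stays live. -/
inductive ReadRequest {V : Type*} : State V → Request V → State V → Prop
  | arriveNew (s : State V) (v : V) (E : List (Sym2 V)) (hv : v ∉ s.live) (hE : E.Nodup)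
      (hmem : ∀ e, e ∈ E ↔ ∃ w ∈ s.live, e = s(v, w)) :
      ReadRequest s (Request.arrive v) ⟨insert v s.active, insert v s.live, s.perm ++ E⟩
  | arriveLive (s : State V) (v : V) (hv : v ∈ s.live) :
      ReadRequest s (Request.arrive v) ⟨insert v s.active, s.live, s.perm⟩
  | depart (s : State V) (v : V) :
      ReadRequest s (Request.depart v) ⟨s.active.erase v, s.live, s.perm⟩

/-- `s'` is a possible state after request `r` in state `s`: read the request, then perform steps
until no step is possible. -/
def Update {V : Type*} [MetricSpace V] (γ : ℝ) (s : State V) (r : Request V) (s' : State V) :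
    Prop :=
  ∃ s₀, ReadRequest s r s₀ ∧ Relation.ReflTransGen (Step γ) s₀ s' ∧ ¬ ∃ s₁, Step γ s' s₁

/-- `S` maps each legal history to the state of the local search after it, for some deterministic
way of making all choices (order of new edges, choice of the next step). -/
def IsLocalSearch {V : Type*} [MetricSpace V] (γ : ℝ) (S : List (Request V) → State V) : Prop :=
  S [] = ⟨∅, ∅, []⟩ ∧ ∀ r σ, Legal (r :: σ) → Update γ (S σ) r (S (r :: σ))

/-- After every request the loop ends, in whichever way the choices are made. -/
def AlwaysTerminates {V : Type*} [MetricSpace V] (γ : ℝ) (S : List (Request V) → State V) :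
    Prop :=
  ∀ r σ, Legal (r :: σ) →
    ¬ ∃ x : ℕ → State V, ReadRequest (S σ) r (x 0) ∧ ∀ n, Step γ (x n) (x (n + 1))

/-- The online algorithm that outputs the current solution of the local search. -/
noncomputable def outputOf {V : Type*} [MetricSpace V] (S : List (Request V) → State V) :
    OnlineAlgorithm V :=
  fun σ => (S σ).tree

end DynSteiner

/-! The coverage of an edge is 1 if the edges before it in `π` do not span it and 0 otherwise
(`rankFn_insert_sub`). Hence the current solution is the greedy forest of `π`, and a density is the
inverse length on that forest and 0 off it (`State.WellFormed.density_eq`). As `π` lists all edges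
of the complete graph on the live vertices, the solution is always a spanning tree of them.

Every step then has a simple effect on this tree. A local move either keeps the tree and moves one
of its edges past edges of smaller density, or replaces a tree edge by one at least `γ` times
cheaper (`LocalMove.cases_tree`). Cleaning removes at most one edge at a vertex or replaces a path
of two edges by its shortcut (`CleanStep.cases_tree`).

Termination: cleaning lowers the number of live vertices; between cleanings the pair (cost, delay)
falls lexicographically while the permutations range over a finite set.

Recourse: give each tree edge the potential `1 + log (length / dmin)`, which lies between 1 and `1 +
log D`. A request adds at most one edge. An exchange lowers the potential by at least `log γ = 2`, a
deletion by at least 1 per deleted edge, and a shortcut by at least `1 - log 2 > 3/10`, so the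
recourse of steps is at most 10 times the drop.

Competitiveness: in a final state any two live vertices `x`, `y` are joined by tree edges shorter
than `γ * dist x y` (`State.WellFormed.joined_short`), and Steiner vertices have degree at least 3.
Fix `r` and let `p` be the number of components of the tree edges shorter than `r` that contain a
terminal. The degree condition bounds the number of remaining tree edges by `3p - 3`
(`exists_separated_terminals`). A tour of the terminals along a doubled Steiner tree `E` makes at
least `p - 1` steps between these components, each of length `d` with `r ≤ γ * d`. So above every
threshold there are at most as many tree edges as entries in three copies of the tour scaled by `γ`;
comparing sums gives cost at most `3γ · 2 · cost E`. -/

namespace DynSteiner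

/-! ## Connectivity by sets of edges -/

/-- Two vertices are joined by a walk along edges in `S`. -/
abbrev Joined {V : Type*} (S : Set (Sym2 V)) (x y : V) : Prop :=
  (SimpleGraph.fromEdgeSet S).Reachable x y

/-- The end points of `e` are joined in `S`; equivalently `e` lies in the closure of `S` in the
graphic matroid. -/
def Spanned {V : Type*} (S : Set (Sym2 V)) (e : Sym2 V) : Prop :=
  ∀ x y, e = s(x, y) → Joined S x y

section Joined

variable {V W : Type*} {S T : Set (Sym2 V)} {e f : Sym2 V} {x y z p q : V}

theorem joined_of_mem (h : s(x, y) ∈ S) : Joined S x y := by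
  by_cases hxy : x = y
  · subst hxy; exact SimpleGraph.Reachable.refl _
  · exact SimpleGraph.Adj.reachable ((SimpleGraph.fromEdgeSet_adj S).2 ⟨h, hxy⟩)

/-- Being joined is the least equivalence relation that relates the end points of the edges. -/
theorem Joined.lift {r : V → V → Prop} (hr : Equivalence r)
    (hS : ∀ a b, s(a, b) ∈ S → r a b) (h : Joined S x y) : r x y := by
  obtain ⟨w⟩ := h
  induction w with
  | nil => exact hr.refl _
  | cons hadj _ ih =>
    exact hr.trans (hS _ _ ((SimpleGraph.fromEdgeSet_adj S).1 hadj).1) ih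

theorem joined_equivalence (S : Set (Sym2 V)) : Equivalence (Joined S) :=
  ⟨fun _ => SimpleGraph.Reachable.refl _, fun h => h.symm, fun h k => h.trans k⟩

theorem Joined.map {S' : Set (Sym2 W)} (g : V → W)
    (hS : ∀ a b, s(a, b) ∈ S → Joined S' (g a) (g b)) (h : Joined S x y) :
    Joined S' (g x) (g y) :=
  Joined.lift (r := fun a b => Joined S' (g a) (g b))
    ⟨fun _ => SimpleGraph.Reachable.refl _, fun h => h.symm, fun h k => h.trans k⟩ hS h

theorem Joined.mono (hST : S ⊆ T) (h : Joined S x y) : Joined T x y :=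
  SimpleGraph.Reachable.mono (SimpleGraph.fromEdgeSet_mono hST) h

theorem joined_empty : Joined (∅ : Set (Sym2 V)) x y ↔ x = y := by
  constructor
  · exact fun h => Joined.lift eq_equivalence (by simp) h
  · rintro rfl; exact SimpleGraph.Reachable.refl _

/-- A walk needs the new edge at most once. Formally, the right side is itself an equivalence
relation containing all edges, so `Joined.lift` applies. -/
theorem joined_insert : Joined (insert s(p, q) S) x y ↔
    Joined S x y ∨ (Joined S x p ∧ Joined S q y) ∨ (Joined S x q ∧ Joined S p y) := by
  constructor
  · intro h
    have hr := joined_equivalence S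
    refine Joined.lift (S := insert s(p, q) S) (r := fun x y => Joined S x y ∨
      (Joined S x p ∧ Joined S q y) ∨ (Joined S x q ∧ Joined S p y)) ⟨?_, ?_, ?_⟩ ?_ h
    · exact fun x => Or.inl (hr.refl x)
    · rintro x y (h | ⟨h, k⟩ | ⟨h, k⟩)
      · exact Or.inl h.symm
      · exact Or.inr (Or.inr ⟨k.symm, h.symm⟩)
      · exact Or.inr (Or.inl ⟨k.symm, h.symm⟩)
    · rintro x y z (h | ⟨h, k⟩ | ⟨h, k⟩) (h' | ⟨h', k'⟩ | ⟨h', k'⟩)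
      · exact Or.inl (h.trans h')
      · exact Or.inr (Or.inl ⟨h.trans h', k'⟩)
      · exact Or.inr (Or.inr ⟨h.trans h', k'⟩)
      · exact Or.inr (Or.inl ⟨h, k.trans h'⟩)
      · exact Or.inr (Or.inl ⟨h, k'⟩)
      · exact Or.inl (h.trans k')
      · exact Or.inr (Or.inr ⟨h, k.trans h'⟩)
      · exact Or.inl (h.trans k')
      · exact Or.inr (Or.inr ⟨h, k'⟩)
    · rintro a b (hab | hab)
      · rcases Sym2.eq_iff.1 hab with ⟨rfl, rfl⟩ | ⟨rfl, rfl⟩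
        · exact Or.inr (Or.inl ⟨hr.refl _, hr.refl _⟩)
        · exact Or.inr (Or.inr ⟨hr.refl _, hr.refl _⟩)
      · exact Or.inl (joined_of_mem hab)
  · have hpq : Joined (insert s(p, q) S) p q := joined_of_mem (Set.mem_insert _ _)
    have hm : ∀ {a b}, Joined S a b → Joined (insert s(p, q) S) a b :=
      fun h => h.mono (Set.subset_insert _ _)
    rintro (h | ⟨h, k⟩ | ⟨h, k⟩)
    · exact hm h
    · exact ((hm h).trans hpq).trans (hm k)
    · exact ((hm h).trans hpq.symm).trans (hm k)

theorem spanned_mk : Spanned S s(x, y) ↔ Joined S x y := by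
  refine ⟨fun h => h _ _ rfl, fun h a b hab => ?_⟩
  rcases Sym2.eq_iff.1 hab with ⟨rfl, rfl⟩ | ⟨rfl, rfl⟩
  · exact h
  · exact h.symm

theorem spanned_of_mem (h : e ∈ S) : Spanned S e := by
  rintro x y rfl; exact joined_of_mem h

theorem Spanned.mono (hST : S ⊆ T) (h : Spanned S e) : Spanned T e :=
  fun x y hxy => (h x y hxy).mono hST

theorem Spanned.trans (hST : ∀ f ∈ S, Spanned T f) (h : Spanned S e) : Spanned T e :=
  fun x y hxy => Joined.lift (joined_equivalence T) (fun a b hab => hST _ hab a b rfl)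
    (h x y hxy)

/-- The exchange property of matroid closure: a walk joining the ends of `e` must use `f`, so it
closes a cycle through both edges. -/
theorem Spanned.exchange (h : Spanned (insert f S) e) (h' : ¬ Spanned S e) :
    Spanned (insert e S) f := by
  induction e with | h x y
  induction f with | h p q
  rw [spanned_mk, joined_insert] at h ⊢
  rw [spanned_mk] at h'
  rcases h with h | ⟨h, k⟩ | ⟨h, k⟩
  · exact absurd h h'
  · exact Or.inr (Or.inl ⟨h.symm, k.symm⟩)
  · exact Or.inr (Or.inr ⟨k, h⟩)

/-- Adding a spanned edge does not change the span. -/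
theorem spanned_insert_iff (h : Spanned S f) : Spanned (insert f S) e ↔ Spanned S e :=
  ⟨fun k => k.trans (by
    rintro g (rfl | hg)
    · exact h
    · exact spanned_of_mem hg), fun k => k.mono (Set.subset_insert _ _)⟩

/-- `F` is independent in the graphic matroid. -/
def Indep (F : Set (Sym2 V)) : Prop := ∀ e ∈ F, ¬ Spanned (F \ {e}) e

theorem Indep.mono (hT : Indep T) (hST : S ⊆ T) : Indep S :=
  fun e he h => hT e (hST he) (h.mono (Set.sdiff_subset_sdiff_left hST))

theorem indep_empty : Indep (∅ : Set (Sym2 V)) := fun _ he => absurd he (Set.notMem_empty _)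

/-- If some `f` of `S` became spanned by the others together with `e`, exchange would put `e` into
the span of `S`. -/
theorem Indep.insert_of_not_spanned (hS : Indep S) (he : ¬ Spanned S e) : Indep (insert e S) := by
  have heS : e ∉ S := fun h => he (spanned_of_mem h)
  rintro f (rfl | hf) h
  · exact he (h.mono (by rintro x ⟨rfl | hx, hne⟩; exacts [absurd rfl hne, hx]))
  · have hef : e ≠ f := fun h => heS (h ▸ hf)
    have h1 : Spanned (insert e (S \ {f})) f := h.mono (by
      rintro x ⟨rfl | hx, hne⟩
      exacts [Set.mem_insert _ _, Set.mem_insert_of_mem _ ⟨hx, hne⟩])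
    have h2 := h1.exchange (hS f hf)
    rw [Set.insert_sdiff_singleton, Set.insert_eq_of_mem hf] at h2
    exact he h2

theorem Indep.isAcyclic (hS : Indep S) : (SimpleGraph.fromEdgeSet S).IsAcyclic := by
  rw [SimpleGraph.isAcyclic_iff_forall_isBridge]
  intro e he
  induction e with | h x y
  rw [SimpleGraph.isBridge_iff]
  intro h
  rw [SimpleGraph.edgeSet_fromEdgeSet] at he
  apply hS _ he.1
  rw [spanned_mk]
  refine h.mono ?_
  intro a b hab
  rw [SimpleGraph.deleteEdges_adj, SimpleGraph.fromEdgeSet_adj] at hab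
  exact (SimpleGraph.fromEdgeSet_adj _).2 ⟨⟨hab.1.1, hab.2⟩, hab.1.2⟩

end Joined

/-! ## The rank function -/

section Rank

variable {V W : Type*} {S : Set (Sym2 V)} {e : Sym2 V} {L : Finset V} {x y : V}

/-- All edges of `S` are between vertices of `L`. -/
def Within (L : Finset V) (S : Set (Sym2 V)) : Prop := ∀ e ∈ S, ∀ x ∈ e, x ∈ L

theorem Within.mono {T : Set (Sym2 V)} (hT : Within L T) (hST : S ⊆ T) : Within L S :=
  fun e he => hT e (hST he)

theorem reachable_induce_iff (hS : Within L S) (a b : (L : Set V)) :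
    ((SimpleGraph.fromEdgeSet S).induce (L : Set V)).Reachable a b ↔ Joined S (a : V) b := by
  classical
  constructor
  · exact fun h => h.map (SimpleGraph.Embedding.induce (L : Set V)).toHom
  · intro h
    -- A retraction onto `L`; its value outside `L` is irrelevant, since no edge of `S` leaves `L`.
    let g : V → (L : Set V) := fun v => if hv : v ∈ L then ⟨v, hv⟩ else a
    have hg : ∀ c : (L : Set V), g c = c := fun c => by
      have : (c : V) ∈ L := c.2
      simp [g, this]
    have key := Joined.lift (S := S) (r := fun u v =>
      ((SimpleGraph.fromEdgeSet S).induce (L : Set V)).Reachable (g u) (g v))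
      ⟨fun _ => SimpleGraph.Reachable.refl _, fun h => h.symm, fun h k => h.trans k⟩ (by
        intro u v huv
        have hu : u ∈ L := hS _ huv u (by simp)
        have hv : v ∈ L := hS _ huv v (by simp)
        by_cases huv' : u = v
        · subst huv'; exact SimpleGraph.Reachable.refl _
        · apply SimpleGraph.Adj.reachable
          simp only [g, hu, hv, dif_pos]
          rw [SimpleGraph.comap_adj]
          exact (SimpleGraph.fromEdgeSet_adj S).2 ⟨huv, huv'⟩) h
    simpa only [hg] using key

theorem card_connectedComponent_congr {G H : SimpleGraph W}
    (h : ∀ a b, H.Reachable a b ↔ G.Reachable a b) :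
    Nat.card H.ConnectedComponent = Nat.card G.ConnectedComponent := by
  refine Nat.card_congr (Quot.congr (Equiv.refl W) ?_)
  exact h

/-- The natural map from components of `G` to components of `H` becomes a bijection once the
component of `y` is left out. -/
theorem card_connectedComponent_merge [Finite W] {G H : SimpleGraph W} {x y : W}
    (hxy : ¬ G.Reachable x y)
    (h : ∀ a b, H.Reachable a b ↔ G.Reachable a b ∨ (G.Reachable a x ∧ G.Reachable y b) ∨
      (G.Reachable a y ∧ G.Reachable x b)) :
    Nat.card G.ConnectedComponent = Nat.card H.ConnectedComponent + 1 := by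
  classical
  let cy := G.connectedComponentMk y
  let g : G.ConnectedComponent → H.ConnectedComponent :=
    SimpleGraph.ConnectedComponent.lift (fun v => H.connectedComponentMk v)
      (fun v w p _ => SimpleGraph.ConnectedComponent.sound ((h v w).2 (Or.inl ⟨p⟩)))
  have hbij : Function.Bijective (fun c : {c // c ≠ cy} => g c) := by
    constructor
    · rintro ⟨c, hc⟩ ⟨d, hd⟩ hcd
      induction c using SimpleGraph.ConnectedComponent.ind with | h a
      induction d using SimpleGraph.ConnectedComponent.ind with | h b
      have hab : H.Reachable a b := SimpleGraph.ConnectedComponent.exact hcd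
      rw [Subtype.mk.injEq]
      apply SimpleGraph.ConnectedComponent.sound
      rcases (h a b).1 hab with k | ⟨_, k⟩ | ⟨k, _⟩
      · exact k
      · exact absurd (SimpleGraph.ConnectedComponent.sound k.symm) hd
      · exact absurd (SimpleGraph.ConnectedComponent.sound k) hc
    · intro c
      induction c using SimpleGraph.ConnectedComponent.ind with | h a
      by_cases ha : G.Reachable a y
      · refine ⟨⟨G.connectedComponentMk x, fun k =>
          hxy (SimpleGraph.ConnectedComponent.exact k)⟩, ?_⟩
        exact SimpleGraph.ConnectedComponent.sound
          ((h x a).2 (Or.inr (Or.inl ⟨SimpleGraph.Reachable.refl _, ha.symm⟩)))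
      · exact ⟨⟨G.connectedComponentMk a, fun k =>
          ha (SimpleGraph.ConnectedComponent.exact k)⟩, rfl⟩
  rw [← Nat.card_congr (Equiv.ofBijective _ hbij), ← Finite.card_option]
  exact (Nat.card_congr (Equiv.optionSubtypeNe cy)).symm

open scoped Classical in
-- An edge either lies inside a component or merges exactly two. This replaces the rank function by
-- spanning in all that follows.
theorem rankFn_insert_sub (hS : Within L S) (he : ∀ x ∈ e, x ∈ L) :
    rankFn L (insert e S) - rankFn L S = if Spanned S e then 0 else 1 := by
  induction e with | h x y
  have hx : x ∈ L := he x (by simp)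
  have hy : y ∈ L := he y (by simp)
  have hS' : Within L (insert s(x, y) S) := by
    rintro e (rfl | h)
    exacts [he, hS e h]
  rw [spanned_mk]
  unfold rankFn
  split_ifs with h
  · rw [card_connectedComponent_congr (G := (SimpleGraph.fromEdgeSet S).induce (L : Set V))]
    · ring
    · intro a b
      rw [reachable_induce_iff hS', reachable_induce_iff hS, joined_insert]
      constructor
      · rintro (k | ⟨k, l⟩ | ⟨k, l⟩)
        exacts [k, (k.trans h).trans l, (k.trans h.symm).trans l]
      · exact Or.inl
  · rw [card_connectedComponent_merge (G := (SimpleGraph.fromEdgeSet S).induce (L : Set V))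
      (H := (SimpleGraph.fromEdgeSet (insert s(x, y) S)).induce (L : Set V))
      (x := ⟨x, hx⟩) (y := ⟨y, hy⟩)]
    · push_cast; ring
    · rwa [reachable_induce_iff hS]
    · intro a b
      simp only [reachable_induce_iff hS', reachable_induce_iff hS, joined_insert]

end Rank

/-! ## The greedy forest of a list of edges -/

section Greedy

variable {V : Type*} {S S' : Set (Sym2 V)} {e f u : Sym2 V} {X Y B l π : List (Sym2 V)}

theorem spanned_insert_congr (h : ∀ e, Spanned S e ↔ Spanned S' e) (e : Sym2 V) :
    Spanned (insert f S) e ↔ Spanned (insert f S') e := by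
  have aux : ∀ {S S' : Set (Sym2 V)}, (∀ e, Spanned S e ↔ Spanned S' e) →
      Spanned (insert f S) e → Spanned (insert f S') e := fun {S S'} h k => k.trans (by
    rintro g (rfl | hg)
    · exact spanned_of_mem (Set.mem_insert _ _)
    · exact ((h g).1 (spanned_of_mem hg)).mono (Set.subset_insert _ _))
  exact ⟨aux h, aux fun e => (h e).symm⟩

open scoped Classical in
/-- Scan the list and keep each edge that is not spanned by `S` and the edges before it. -/
noncomputable def greedy (S : Set (Sym2 V)) : List (Sym2 V) → List (Sym2 V)
  | [] => []
  | e :: l => if Spanned S e then greedy (insert e S) l else e :: greedy (insert e S) l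

theorem greedy_cons_of_spanned (h : Spanned S e) : greedy S (e :: l) = greedy (insert e S) l := by
  rw [greedy, if_pos h]

theorem greedy_cons_of_not_spanned (h : ¬ Spanned S e) :
    greedy S (e :: l) = e :: greedy (insert e S) l := by
  rw [greedy, if_neg h]

theorem insert_union_mem (S : Set (Sym2 V)) (e : Sym2 V) (l : List (Sym2 V)) :
    insert e S ∪ {x | x ∈ l} = S ∪ {x | x ∈ e :: l} := by
  ext x; simp only [Set.mem_union, Set.mem_insert_iff, Set.mem_ofPred_eq, List.mem_cons]; tauto

/-- The start set accumulates every scanned edge, rejected ones included, so it is simply `S` plus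
the prefix. -/
theorem greedy_append (S : Set (Sym2 V)) (X Y : List (Sym2 V)) :
    greedy S (X ++ Y) = greedy S X ++ greedy (S ∪ {x | x ∈ X}) Y := by
  induction X generalizing S with
  | nil => simp [greedy]
  | cons e X ih =>
    rw [List.cons_append, ← insert_union_mem]
    by_cases h : Spanned S e
    · rw [greedy_cons_of_spanned h, greedy_cons_of_spanned h, ih]
    · rw [greedy_cons_of_not_spanned h, greedy_cons_of_not_spanned h, ih, List.cons_append]

theorem greedy_congr (h : ∀ e, Spanned S e ↔ Spanned S' e) : greedy S l = greedy S' l := by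
  induction l generalizing S S' with
  | nil => rfl
  | cons e l ih =>
    have := ih (spanned_insert_congr (f := e) h)
    by_cases hs : Spanned S e
    · rw [greedy_cons_of_spanned hs, greedy_cons_of_spanned ((h e).1 hs), this]
    · rw [greedy_cons_of_not_spanned hs, greedy_cons_of_not_spanned (mt (h e).2 hs), this]

theorem mem_of_mem_greedy (h : e ∈ greedy S l) : e ∈ l ∧ ¬ Spanned S e := by
  induction l generalizing S with
  | nil => simp [greedy] at h
  | cons a l ih =>
    have aux : e ∈ greedy (insert a S) l → e ∈ a :: l ∧ ¬ Spanned S e := fun h =>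
      ⟨List.mem_cons_of_mem _ (ih h).1, fun k => (ih h).2 (k.mono (Set.subset_insert _ _))⟩
    by_cases hs : Spanned S a
    · rw [greedy_cons_of_spanned hs] at h
      exact aux h
    · rw [greedy_cons_of_not_spanned hs, List.mem_cons] at h
      rcases h with rfl | h
      · exact ⟨List.mem_cons_self, hs⟩
      · exact aux h

theorem greedy_nodup (S : Set (Sym2 V)) (l : List (Sym2 V)) : (greedy S l).Nodup := by
  induction l generalizing S with
  | nil => simp [greedy]
  | cons a l ih =>
    by_cases hs : Spanned S a
    · rw [greedy_cons_of_spanned hs]; exact ih _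
    · rw [greedy_cons_of_not_spanned hs, List.nodup_cons]
      exact ⟨fun h => (mem_of_mem_greedy h).2 (spanned_of_mem (Set.mem_insert _ _)), ih _⟩

/-- The kept edges span all edges. -/
theorem Spanned.greedy (h : Spanned (S ∪ {x | x ∈ l}) e) :
    Spanned (S ∪ {x | x ∈ greedy S l}) e := by
  induction l generalizing S with
  | nil => simpa [DynSteiner.greedy] using h
  | cons a l ih =>
    rw [← insert_union_mem] at h
    have h1 := ih h
    by_cases hs : Spanned S a
    · rw [greedy_cons_of_spanned hs]
      refine h1.trans ?_
      rintro f ((rfl | hf) | hf)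
      · exact hs.mono Set.subset_union_left
      · exact spanned_of_mem (Or.inl hf)
      · exact spanned_of_mem (Or.inr hf)
    · rw [greedy_cons_of_not_spanned hs, ← insert_union_mem]
      exact h1

theorem Indep.greedy (h : Indep S) : Indep (S ∪ {x | x ∈ greedy S l}) := by
  -- The induction carries two sets of equal span: `S` collects only the kept edges and stays
  -- independent, `S'` collects all scanned edges.
  have aux : ∀ {l : List (Sym2 V)} {S S' : Set (Sym2 V)}, (∀ e, Spanned S e ↔ Spanned S' e) →
      Indep S → Indep (S ∪ {x | x ∈ DynSteiner.greedy S' l}) := by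
    intro l
    induction l with
    | nil => intro S S' _ h; simpa [DynSteiner.greedy] using h
    | cons a l ih =>
      intro S S' hS h
      by_cases hs : Spanned S' a
      · rw [greedy_cons_of_spanned hs]
        exact ih (fun e => (hS e).trans (spanned_insert_iff hs).symm) h
      · rw [greedy_cons_of_not_spanned hs, ← insert_union_mem]
        exact ih (spanned_insert_congr hS) (h.insert_of_not_spanned (mt (hS a).1 hs))
  exact aux (fun _ => Iff.rfl) h

/-- If starting with `u` caused an edge of `B` to be rejected, exchange would make `u` spanned at
that moment. -/
theorem greedy_insert_of_not_spanned (h : ¬ Spanned (S ∪ {x | x ∈ B}) u) :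
    greedy (insert u S) B = greedy S B := by
  induction B generalizing S with
  | nil => rfl
  | cons e B ih =>
    have hi : ¬ Spanned (insert e S) u := fun k => h (k.mono (by
      rw [← insert_union_mem]; exact Set.subset_union_left))
    have h' := ih (S := insert e S) (by rwa [insert_union_mem])
    rw [Set.insert_comm] at h'
    by_cases hs : Spanned S e
    · rw [greedy_cons_of_spanned hs, greedy_cons_of_spanned (hs.mono (Set.subset_insert _ _)), h']
    · rw [greedy_cons_of_not_spanned hs,
        greedy_cons_of_not_spanned (fun k => hi (k.exchange hs)), h']

/-- If `u` becomes spanned while `B` is scanned, then starting with `u` instead drops exactly one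
edge of `B`. -/
theorem exists_greedy_perm_cons (h : ¬ Spanned S u) (h' : Spanned (S ∪ {x | x ∈ B}) u) :
    ∃ b ∈ greedy S B, (greedy S B).Perm (b :: greedy (insert u S) B) := by
  induction B generalizing S with
  | nil => simp at h'; exact absurd h' h
  | cons e B ih =>
    -- The dropped edge is the `e` at which `u` first becomes spanned; from then on both scans have
    -- the same span.
    by_cases hi : Spanned (insert e S) u
    · have hs : ¬ Spanned S e := fun k => h ((spanned_insert_iff k).1 hi)
      have hs' : Spanned (insert u S) e := hi.exchange h
      rw [greedy_cons_of_not_spanned hs, greedy_cons_of_spanned hs']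
      refine ⟨e, List.mem_cons_self, ?_⟩
      rw [greedy_congr (S := insert e (insert u S)) (S' := insert e S)]
      intro f
      rw [Set.insert_comm]
      exact spanned_insert_iff hi
    · obtain ⟨b, hb, hp⟩ := ih hi (by rwa [insert_union_mem])
      rw [Set.insert_comm] at hp
      by_cases hs : Spanned S e
      · rw [greedy_cons_of_spanned hs, greedy_cons_of_spanned (hs.mono (Set.subset_insert _ _))]
        exact ⟨b, hb, hp⟩
      · rw [greedy_cons_of_not_spanned hs,
          greedy_cons_of_not_spanned (fun k => hi (k.exchange hs))]
        exact ⟨b, List.mem_cons_of_mem _ hb, (hp.cons e).trans (List.Perm.swap _ _ _)⟩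

theorem setOf_mem_append (X Y : List (Sym2 V)) :
    {x | x ∈ X ++ Y} = {x | x ∈ X} ∪ {x | x ∈ Y} := by ext; simp

/-- Moving an edge of the forest forward does not change the forest. -/
theorem greedy_move_perm (h : ¬ Spanned {x | x ∈ X ++ B} u) :
    (greedy ∅ (X ++ u :: (B ++ Y))).Perm (greedy ∅ (X ++ (B ++ u :: Y))) := by
  rw [setOf_mem_append] at h
  have hX : ¬ Spanned {x | x ∈ X} u := fun k => h (k.mono Set.subset_union_left)
  rw [greedy_append, greedy_append ∅ X, Set.empty_union, greedy_cons_of_not_spanned hX,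
    greedy_append, greedy_append _ B, greedy_cons_of_not_spanned h,
    greedy_insert_of_not_spanned h, Set.insert_union]
  exact (List.perm_middle.symm).append_left _

/-- Moving an edge `u` forward such that it enters the forest removes one edge of the forest. -/
theorem greedy_move_exchange (h : ¬ Spanned {x | x ∈ X} u) (h' : Spanned {x | x ∈ X ++ B} u) :
    ∃ b ∈ B, b ∈ greedy ∅ (X ++ (B ++ u :: Y)) ∧
      (b :: greedy ∅ (X ++ u :: (B ++ Y))).Perm (u :: greedy ∅ (X ++ (B ++ u :: Y))) := by
  rw [setOf_mem_append] at h'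
  obtain ⟨b, hb, hp⟩ := exists_greedy_perm_cons h h'
  refine ⟨b, (mem_of_mem_greedy hb).1, ?_, ?_⟩
  · rw [greedy_append, greedy_append, Set.empty_union]
    simp [hb]
  · rw [greedy_append, greedy_append ∅ X, Set.empty_union, greedy_cons_of_not_spanned h,
      greedy_append, greedy_append _ B, greedy_cons_of_spanned h', Set.insert_union]
    refine List.Perm.trans (List.perm_middle.symm) ?_
    refine List.Perm.trans ?_ List.perm_middle
    refine List.Perm.append_left _ ?_
    refine (List.Perm.swap _ _ _).trans (List.Perm.cons _ ?_)
    exact hp.symm.append_right _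

/-! ### Preceding edges -/

theorem preceding_append (he : e ∉ X) : preceding (X ++ e :: Y) e = {x | x ∈ X} := by
  unfold preceding
  rw [List.takeWhile_append_of_pos]
  · simp
  · intro a ha
    have hae : a ≠ e := fun h => he (h ▸ ha)
    simpa using hae

theorem exists_eq_append_of_mem (h : e ∈ l) : ∃ X Y, l = X ++ e :: Y ∧ e ∉ X := by
  induction l with
  | nil => simp at h
  | cons a l ih =>
    by_cases hae : e = a
    · subst hae; exact ⟨[], l, rfl, by simp⟩
    · obtain ⟨X, Y, rfl, hX⟩ := ih ((List.mem_cons.1 h).resolve_left hae)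
      exact ⟨a :: X, Y, rfl, by simp [hae, hX]⟩

theorem mem_greedy : e ∈ greedy ∅ l ↔ e ∈ l ∧ ¬ Spanned (preceding l e) e := by
  constructor
  · intro h
    refine ⟨(mem_of_mem_greedy h).1, ?_⟩
    obtain ⟨X, Y, rfl, hX⟩ := exists_eq_append_of_mem (mem_of_mem_greedy h).1
    rw [preceding_append hX]
    rw [greedy_append, List.mem_append, Set.empty_union] at h
    rcases h with h | h
    · exact absurd (mem_of_mem_greedy h).1 hX
    · exact (mem_of_mem_greedy h).2
  · rintro ⟨h, h'⟩
    obtain ⟨X, Y, rfl, hX⟩ := exists_eq_append_of_mem h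
    rw [preceding_append hX] at h'
    rw [greedy_append, Set.empty_union, greedy_cons_of_not_spanned h']
    simp

/-- A spanned edge is spanned by forest edges before it. -/
theorem spanned_greedy_inter_preceding (h : e ∈ l)
    (he : Spanned (preceding l e) f) : Spanned ({x | x ∈ greedy ∅ l} ∩ preceding l e) f := by
  obtain ⟨X, Y, rfl, hX⟩ := exists_eq_append_of_mem h
  rw [preceding_append hX] at he ⊢
  have h1 : Spanned (∅ ∪ {x | x ∈ X}) f := by rwa [Set.empty_union]
  refine h1.greedy.mono ?_
  rw [Set.empty_union]
  intro x hx
  refine ⟨?_, (mem_of_mem_greedy hx).1⟩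
  change x ∈ greedy ∅ _
  rw [greedy_append]
  exact List.mem_append_left _ hx

theorem mem_of_mem_preceding (h : f ∈ preceding l e) : f ∈ l ∧ f ≠ e := by
  unfold preceding at h
  refine ⟨(List.takeWhile_subset _ h), ?_⟩
  have := List.mem_takeWhile_imp h
  simpa using this

theorem preceding_subset (he : e ∈ l) (h : f ∈ preceding l e) :
    preceding l f ⊆ preceding l e := by
  obtain ⟨X, Y, rfl, hX⟩ := exists_eq_append_of_mem he
  rw [preceding_append hX] at h ⊢
  obtain ⟨X1, X2, rfl, hX1⟩ := exists_eq_append_of_mem h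
  rw [List.append_assoc, List.cons_append, preceding_append hX1]
  intro x hx
  exact List.mem_append_left _ hx

/-- An independent set of edges such that every other edge is spanned by earlier edges of the set
is the greedy forest. -/
theorem mem_greedy_iff_of_indep {F : Set (Sym2 V)} (hF : Indep F) (hFl : ∀ e ∈ F, e ∈ l)
    (h : ∀ e ∈ l, e ∉ F → Spanned (F ∩ preceding l e) e) (e : Sym2 V) :
    e ∈ greedy ∅ l ↔ e ∈ F := by
  rw [mem_greedy]
  constructor
  · rintro ⟨hel, hs⟩
    by_contra heF
    exact hs ((h e hel heF).mono Set.inter_subset_right)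
  · intro heF
    have hel := hFl e heF
    refine ⟨hel, fun hs => hF e heF ?_⟩
    -- Every edge before `e` is in `F` or spanned by still earlier members of `F`, so the prefix has
    -- the span of its part in `F`.
    have h1 : Spanned (F ∩ preceding l e) e := hs.trans (by
      intro f hf
      by_cases hfF : f ∈ F
      · exact spanned_of_mem ⟨hfF, hf⟩
      · exact (h f (mem_of_mem_preceding hf).1 hfF).mono
          (Set.inter_subset_inter_right _ (preceding_subset hel hf)))
    exact h1.mono fun x hx => ⟨hx.1, (mem_of_mem_preceding hx.2).2⟩

end Greedy

/-! ## Well-formed states -/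

section Density

variable {V : Type*} [MetricSpace V] {e u : Sym2 V} {L : Finset V} {π : List (Sym2 V)}

theorem edgeCost_mk (x y : V) : edgeCost s(x, y) = dist x y := rfl

theorem edgeCost_nonneg (e : Sym2 V) : 0 ≤ edgeCost e := by
  induction e with | h x y
  exact dist_nonneg

theorem edgeCost_pos (h : ¬ e.IsDiag) : 0 < edgeCost e := by
  induction e with | h x y
  exact dist_pos.2 (by simpa using h)

/-- The members of `π` are proper edges between vertices of `L`. -/
def ValidEdges (L : Finset V) (π : List (Sym2 V)) : Prop :=
  ∀ e ∈ π, ¬ e.IsDiag ∧ ∀ x ∈ e, x ∈ L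

open scoped Classical in
theorem density_eq (hπ : ValidEdges L π) (he : e ∈ π) :
    density L π e = if e ∈ greedy ∅ π then (edgeCost e)⁻¹ else 0 := by
  unfold density
  rw [rankFn_insert_sub (fun f hf => (hπ f (mem_of_mem_preceding hf).1).2) (hπ e he).2]
  by_cases h : Spanned (preceding π e) e
  · rw [if_pos h, if_neg (fun k => (mem_greedy.1 k).2 h), zero_div]
  · rw [if_neg h, if_pos (mem_greedy.2 ⟨he, h⟩), one_div]

theorem density_pos_iff (hπ : ValidEdges L π) (he : e ∈ π) :
    0 < density L π e ↔ e ∈ greedy ∅ π := by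
  rw [density_eq hπ he]
  split_ifs with h
  · simp [h, edgeCost_pos (hπ e he).1]
  · simp [h]

end Density

section State

variable {V : Type*} {s s' : State V} {e u : Sym2 V} {x y : V}

/-- The invariant of the local search: the permutation lists the edges of the complete graph on
the live vertices. -/
structure State.WellFormed (s : State V) : Prop where
  active_subset : s.active ⊆ s.live
  nodup : s.perm.Nodup
  mem_perm : ∀ e, e ∈ s.perm ↔ ¬ e.IsDiag ∧ ∀ x ∈ e, x ∈ s.live

theorem State.WellFormed.valid (h : s.WellFormed) : ValidEdges s.live s.perm :=
  fun e he => (h.mem_perm e).1 he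

theorem State.WellFormed.joined_perm (h : s.WellFormed) (hx : x ∈ s.live) (hy : y ∈ s.live) :
    Joined {e | e ∈ s.perm} x y := by
  by_cases hxy : x = y
  · subst hxy; exact SimpleGraph.Reachable.refl _
  · refine joined_of_mem ((h.mem_perm _).2 ⟨by simpa using hxy, ?_⟩)
    intro z hz
    rcases Sym2.mem_iff.1 hz with rfl | rfl
    exacts [hx, hy]

theorem State.WellFormed.of_perm {A L : Finset V} {π π' : List (Sym2 V)}
    (h : (State.mk A L π).WellFormed) (hp : π'.Perm π) : (State.mk A L π').WellFormed :=
  ⟨h.active_subset, hp.nodup_iff.2 h.nodup, fun e => (hp.mem_iff).trans (h.mem_perm e)⟩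

variable [MetricSpace V]

theorem State.WellFormed.mem_tree (h : s.WellFormed) : e ∈ s.tree ↔ e ∈ greedy ∅ s.perm := by
  classical
  unfold State.tree
  rw [Finset.mem_filter, List.mem_toFinset]
  constructor
  · exact fun k => (density_pos_iff h.valid k.1).1 k.2
  · intro k
    have := (mem_of_mem_greedy k).1
    exact ⟨this, (density_pos_iff h.valid this).2 k⟩

theorem State.WellFormed.coe_tree (h : s.WellFormed) :
    (s.tree : Set (Sym2 V)) = {x | x ∈ greedy ∅ s.perm} := by
  ext e; exact h.mem_tree

theorem State.WellFormed.mem_perm_of_mem_tree (h : s.WellFormed) (he : e ∈ s.tree) :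
    e ∈ s.perm := (mem_of_mem_greedy (h.mem_tree.1 he)).1

theorem State.WellFormed.not_isDiag (h : s.WellFormed) (he : e ∈ s.tree) : ¬ e.IsDiag :=
  ((h.mem_perm e).1 (h.mem_perm_of_mem_tree he)).1

theorem State.WellFormed.within (h : s.WellFormed) : Within s.live (s.tree : Set (Sym2 V)) :=
  fun _ he => ((h.mem_perm _).1 (h.mem_perm_of_mem_tree he)).2

theorem State.WellFormed.indep (h : s.WellFormed) : Indep (s.tree : Set (Sym2 V)) := by
  rw [h.coe_tree]
  have := (indep_empty (V := V)).greedy (l := s.perm)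
  rwa [Set.empty_union] at this

theorem State.WellFormed.joined_tree (h : s.WellFormed) (hx : x ∈ s.live) (hy : y ∈ s.live) :
    Joined (s.tree : Set (Sym2 V)) x y := by
  rw [h.coe_tree, ← spanned_mk]
  have h1 : Spanned (∅ ∪ {e | e ∈ s.perm}) s(x, y) := by
    rw [Set.empty_union, spanned_mk]; exact h.joined_perm hx hy
  simpa using h1.greedy

/-- The terminals are spanned by the current solution, which is a tree on the live vertices. -/
theorem State.WellFormed.isSteinerTree (h : s.WellFormed) : IsSteinerTree s.active s.tree := by
  refine ⟨fun e he => h.not_isDiag he, h.indep.isAcyclic, ?_⟩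
  have aux : ∀ x, (x ∈ s.active ∨ ∃ e ∈ s.tree, x ∈ e) → x ∈ s.live := by
    rintro x (hx | ⟨e, he, hx⟩)
    · exact h.active_subset hx
    · exact h.within e he x hx
  exact fun x y hx hy => h.joined_tree (aux x hx) (aux y hy)

open scoped Classical in
/-- The density of the edges as a function of the current solution. -/
noncomputable def treeDensity (T : Finset (Sym2 V)) (e : Sym2 V) : ℝ :=
  if e ∈ T then (edgeCost e)⁻¹ else 0

theorem treeDensity_nonneg (T : Finset (Sym2 V)) (e : Sym2 V) : 0 ≤ treeDensity T e := by
  unfold treeDensity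
  split_ifs
  exacts [inv_nonneg.2 (edgeCost_nonneg e), le_rfl]

theorem State.WellFormed.density_eq (h : s.WellFormed) (he : e ∈ s.perm) :
    density s.live s.perm e = treeDensity s.tree e := by
  rw [DynSteiner.density_eq h.valid he, treeDensity]
  by_cases k : e ∈ s.tree
  · rw [if_pos k, if_pos (h.mem_tree.1 k)]
  · rw [if_neg k, if_neg (mt h.mem_tree.2 k)]

/-! ### Local moves -/

/-- The sum over the list of position times weight. -/
noncomputable def delay {α : Type*} (w : α → ℝ) : List α → ℝ
  | [] => 0
  | _ :: l => (l.map w).sum + delay w l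

/-- `u` gains one position for each member of `B`, and each member of `B` loses one. -/
theorem delay_move {α : Type*} (w : α → ℝ) (X B Y : List α) (u : α) :
    delay w (X ++ (B ++ u :: Y)) =
      delay w (X ++ u :: (B ++ Y)) + (B.map fun b => w u - w b).sum := by
  induction X with
  | nil =>
    rw [List.nil_append, List.nil_append]
    induction B with
    | nil => simp
    | cons b B ih =>
      simp only [List.cons_append, delay, List.map_cons, List.sum_cons, List.map_append,
        List.sum_append] at ih ⊢
      linarith
  | cons _ X ih =>
    simp only [List.cons_append, delay, ih, List.map_append, List.sum_append, List.map_cons,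
      List.sum_cons]
    ring

theorem sum_map_pos {α : Type*} {g : α → ℝ} {l : List α} (hl : l ≠ []) (h : ∀ a ∈ l, 0 < g a) :
    0 < (l.map g).sum := by
  induction l with
  | nil => exact absurd rfl hl
  | cons a l ih =>
    rw [List.map_cons, List.sum_cons]
    by_cases hl' : l = []
    · subst hl'; simpa using h a (by simp)
    · exact add_pos (h a (by simp)) (ih hl' fun b hb => h b (by simp [hb]))

theorem move_perm {α : Type*} (X B Y : List α) (u : α) :
    (X ++ u :: (B ++ Y)).Perm (X ++ (B ++ u :: Y)) :=
  List.Perm.append_left _ List.perm_middle.symm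

open scoped Classical in
/-- The effect of a local move: either the tree is unchanged and its dense edges move forward, or
an edge is replaced by one that is cheaper by a factor `γ`. -/
theorem LocalMove.cases_tree {γ : ℝ} (hγ : 1 < γ) (hs : s.WellFormed) (hm : LocalMove γ s s') :
    s'.WellFormed ∧ s'.active = s.active ∧ s'.live = s.live ∧ s'.perm.Perm s.perm ∧
      ((s'.tree = s.tree ∧ delay (treeDensity s.tree) s'.perm <
          delay (treeDensity s.tree) s.perm) ∨
        ∃ b ∈ s.tree, ∃ u, ¬ u.IsDiag ∧ u ∉ s.tree ∧ s'.tree = insert u (s.tree.erase b) ∧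
          γ * edgeCost u ≤ edgeCost b) := by
  -- The case common to swaps and `γ`-moves: a tree edge `u` passes a block of edges of smaller
  -- density.
  have key : ∀ (A L : Finset V) (X B Y : List (Sym2 V)) (u : Sym2 V),
      (State.mk A L (X ++ (B ++ u :: Y))).WellFormed → B ≠ [] →
      u ∈ (State.mk A L (X ++ (B ++ u :: Y))).tree →
      (∀ b ∈ B, treeDensity (State.mk A L (X ++ (B ++ u :: Y))).tree b <
        treeDensity (State.mk A L (X ++ (B ++ u :: Y))).tree u) →
      (State.mk A L (X ++ u :: (B ++ Y))).tree = (State.mk A L (X ++ (B ++ u :: Y))).tree ∧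
      delay (treeDensity (State.mk A L (X ++ (B ++ u :: Y))).tree) (X ++ u :: (B ++ Y)) <
        delay (treeDensity (State.mk A L (X ++ (B ++ u :: Y))).tree) (X ++ (B ++ u :: Y)) := by
    intro A L X B Y u h hB hu hlt
    have h' := h.of_perm (move_perm X B Y u)
    refine ⟨?_, ?_⟩
    · have hu' := (mem_greedy.1 (h.mem_tree.1 hu)).2
      have hnd : u ∉ X ++ B := by
        have := h.nodup
        simp only [← List.append_assoc] at this
        exact (List.nodup_middle.1 this |> List.nodup_cons.1).1 ∘ List.mem_append_left _
      have h0 : X ++ (B ++ u :: Y) = (X ++ B) ++ u :: Y := by simp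
      simp only [h0] at hu'
      rw [preceding_append hnd] at hu'
      ext e
      rw [h.mem_tree, h'.mem_tree]
      exact (greedy_move_perm hu').mem_iff
    · rw [delay_move]
      have := sum_map_pos (g := fun b => treeDensity _ u - treeDensity _ b) hB
        (fun b hb => sub_pos.2 (hlt b hb))
      linarith
  cases hm with
  | swap A L X Y e u h =>
    have hs' : (State.mk A L (X ++ u :: e :: Y)).WellFormed := hs.of_perm (move_perm X [e] Y u)
    have he : e ∈ (State.mk A L (X ++ e :: u :: Y)).perm := by simp
    have hu : u ∈ (State.mk A L (X ++ e :: u :: Y)).perm := by simp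
    refine ⟨hs', rfl, rfl, move_perm X [e] Y u, Or.inl ?_⟩
    have h1 := hs.density_eq he
    have h2 := hs.density_eq hu
    simp only at h1 h2
    rw [h1, h2] at h
    -- Densities are nonnegative, so the strictly larger one is positive; a swap therefore always
    -- moves a tree edge forward.
    have h3 : u ∈ (State.mk A L (X ++ e :: u :: Y)).tree := by
      by_contra h3
      have : treeDensity (State.mk A L (X ++ e :: u :: Y)).tree u = 0 := if_neg h3
      rw [this] at h
      exact absurd (treeDensity_nonneg _ e) (not_le.2 h)
    exact key A L X [e] Y u hs (by simp) h3 (by simpa using h)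
  | gammaMove A L X B Y u hB hpos h =>
    have hs' := hs.of_perm (move_perm X B Y u)
    refine ⟨hs', rfl, rfl, move_perm X B Y u, ?_⟩
    have hu' : u ∈ (State.mk A L (X ++ u :: (B ++ Y))).perm := by simp
    have hu : u ∈ (State.mk A L (X ++ (B ++ u :: Y))).perm := by simp
    have hut' : u ∈ (State.mk A L (X ++ u :: (B ++ Y))).tree :=
      hs'.mem_tree.2 ((density_pos_iff hs'.valid hu').1 hpos)
    have hdu := hs'.density_eq hu'
    rw [treeDensity, if_pos hut'] at hdu
    have hud : ¬ u.IsDiag := hs'.not_isDiag hut'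
    have hu0 : 0 < edgeCost u := edgeCost_pos hud
    have hb : ∀ b ∈ B, γ * treeDensity (State.mk A L (X ++ (B ++ u :: Y))).tree b ≤
        (edgeCost u)⁻¹ := by
      intro b hb
      have hbp : b ∈ (State.mk A L (X ++ (B ++ u :: Y))).perm := by simp [hb]
      rw [← hs.density_eq hbp, ← hdu]
      exact h b hb
    by_cases hut : u ∈ (State.mk A L (X ++ (B ++ u :: Y))).tree
    · left
      refine key A L X B Y u hs hB hut fun b hbB => ?_
      have h1 := hb b hbB
      have h0 := treeDensity_nonneg (State.mk A L (X ++ (B ++ u :: Y))).tree b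
      have h2 : treeDensity (State.mk A L (X ++ (B ++ u :: Y))).tree u = (edgeCost u)⁻¹ :=
        if_pos hut
      rw [h2]
      rcases h0.eq_or_lt with h0 | h0
      · rw [← h0]; exact inv_pos.2 hu0
      · nlinarith
    -- Here `u` is spanned by `X ++ B` but not by `X`, so it displaces a tree edge `b` of the block,
    -- to which the density condition applies.
    · right
      have hX : u ∉ X := by
        have := hs'.nodup
        exact fun k => (List.nodup_middle.1 this |> List.nodup_cons.1).1 (List.mem_append_left _ k)
      have hXB : u ∉ X ++ B := by
        have := hs'.nodup
        intro k
        refine (List.nodup_middle.1 this |> List.nodup_cons.1).1 ?_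
        rw [← List.append_assoc]; exact List.mem_append_left _ k
      have h1 : ¬ Spanned {x | x ∈ X} u := by
        have := (mem_greedy.1 (hs'.mem_tree.1 hut')).2
        simp only at this
        rwa [preceding_append hX] at this
      have h2 : Spanned {x | x ∈ X ++ B} u := by
        by_contra h2
        refine hut (hs.mem_tree.2 (mem_greedy.2 ⟨hu, ?_⟩))
        have h0 : X ++ (B ++ u :: Y) = (X ++ B) ++ u :: Y := by simp
        simp only [h0]
        rwa [preceding_append hXB]
      obtain ⟨b, hbB, hbt, hp⟩ := greedy_move_exchange (Y := Y) h1 h2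
      have hbt' : b ∈ (State.mk A L (X ++ (B ++ u :: Y))).tree := hs.mem_tree.2 hbt
      refine ⟨b, hbt', u, hud, hut, ?_, ?_⟩
      · have hbu : b ≠ u := fun k => hut (k ▸ hbt')
        have hnd : (b :: greedy ∅ (X ++ u :: (B ++ Y))).Nodup := by
          rw [hp.nodup_iff, List.nodup_cons]
          exact ⟨fun k => hut (hs.mem_tree.2 k), greedy_nodup _ _⟩
        ext e
        have := hp.mem_iff (a := e)
        rw [List.mem_cons, List.mem_cons] at this
        rw [Finset.mem_insert, Finset.mem_erase, hs.mem_tree, hs'.mem_tree]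
        have hbn := (List.nodup_cons.1 hnd).1
        by_cases heb : e = b
        · subst heb
          simp [hbn, hbu]
        · simp only [heb, false_or] at this
          simp only [this, ne_eq, heb, not_false_eq_true, true_and]
      · have hb0 : 0 < edgeCost b := edgeCost_pos (hs.not_isDiag hbt')
        have := hb b hbB
        rw [treeDensity, if_pos hbt', ← div_eq_mul_inv, div_le_iff₀ hb0, ← div_eq_inv_mul,
          le_div_iff₀ hu0] at this
        exact this

end State

/-! ### Cleaning Steiner vertices -/

section Clean

variable {V : Type*} {S : Set (Sym2 V)} {e : Sym2 V} {v u₁ u₂ : V} {π X Y : List (Sym2 V)}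

theorem preceding_filter {p : Sym2 V → Prop} [DecidablePred p] (h : e ∈ π) (he : p e) :
    preceding (π.filter fun x => p x) e = {x | x ∈ preceding π e ∧ p x} := by
  obtain ⟨X, Y, rfl, hX⟩ := exists_eq_append_of_mem h
  have hX' : e ∉ X.filter (fun x => p x) := fun k => hX (List.mem_filter.1 k).1
  rw [List.filter_append, List.filter_cons_of_pos (by simpa using he), preceding_append hX,
    preceding_append hX']
  ext x; simp

/-- Removing a leaf preserves connections between other vertices. -/
theorem Spanned.remove_leaf (hS : ∀ f ∈ S, ∀ g ∈ S, v ∈ f → v ∈ g → f = g) (h : Spanned S e)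
    (he : v ∉ e) : Spanned {f | f ∈ S ∧ v ∉ f} e := by
  classical
  induction e with | h x y
  rw [spanned_mk] at h ⊢
  rw [Sym2.mem_iff, not_or] at he
  by_cases hw : ∃ w, s(v, w) ∈ S
  · obtain ⟨w, hw⟩ := hw
    -- Contract the leaf `v` into its only neighbour `w`.
    have key := h.map (S' := {f | f ∈ S ∧ v ∉ f}) (Function.update id v w) (by
      have hv : ∀ b, s(v, b) ∈ S → Joined {f | f ∈ S ∧ v ∉ f} (Function.update id v w v)
          (Function.update id v w b) := by
        intro b hb
        have := hS _ hb _ hw (by simp) (by simp)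
        rw [Sym2.congr_right] at this
        subst this
        rw [Function.update_self]
        by_cases hbv : b = v
        · subst hbv; simp
        · rw [Function.update_of_ne hbv]; exact SimpleGraph.Reachable.refl _
      intro a b hab
      by_cases hav : a = v
      · subst hav; exact hv b hab
      by_cases hbv : b = v
      · subst hbv; exact (hv a (by rwa [Sym2.eq_swap])).symm
      rw [Function.update_of_ne hav, Function.update_of_ne hbv]
      refine joined_of_mem ⟨hab, ?_⟩
      rw [Sym2.mem_iff, not_or]
      exact ⟨fun k => hav k.symm, fun k => hbv k.symm⟩)
    rwa [Function.update_of_ne (fun k => he.1 k.symm), Function.update_of_ne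
      (fun k => he.2 k.symm)] at key
  · refine h.mono fun f hf => ⟨hf, fun hvf => hw ?_⟩
    obtain ⟨w, rfl⟩ := Sym2.mem_iff_exists.1 hvf
    exact ⟨w, hf⟩

/-- Contracting an edge at `v`, whose edges lead to two vertices that are joined by an edge. -/
theorem Spanned.shortcut {S' : Set (Sym2 V)} (hS : ∀ f ∈ S, v ∈ f → f = s(v, u₁) ∨ f = s(v, u₂))
    (hu₁ : u₁ ≠ v) (hu₂ : u₂ ≠ v) (hS' : ∀ f ∈ S, v ∉ f → f ∈ S') (hu : s(u₁, u₂) ∈ S')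
    (h : Spanned S e) (he : v ∉ e) : Spanned S' e := by
  classical
  induction e with | h x y
  rw [spanned_mk] at h ⊢
  rw [Sym2.mem_iff, not_or] at he
  -- Moving `v` to `u₁` collapses the edge `s(v, u₁)` and turns `s(v, u₂)` into `s(u₁, u₂)`.
  have key := h.map (S' := S') (Function.update id v u₁) (by
    have hv : ∀ b, s(v, b) ∈ S → Joined S' (Function.update id v u₁ v)
        (Function.update id v u₁ b) := by
      intro b hb
      rw [Function.update_self]
      rcases hS _ hb (by simp) with k | k
      · rw [Sym2.congr_right] at k
        subst k
        rw [Function.update_of_ne hu₁]; exact SimpleGraph.Reachable.refl _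
      · rw [Sym2.congr_right] at k
        subst k
        rw [Function.update_of_ne hu₂]; exact joined_of_mem hu
    intro a b hab
    by_cases hav : a = v
    · subst hav; exact hv b hab
    by_cases hbv : b = v
    · subst hbv; exact (hv a (by rwa [Sym2.eq_swap])).symm
    rw [Function.update_of_ne hav, Function.update_of_ne hbv]
    refine joined_of_mem (hS' _ hab ?_)
    rw [Sym2.mem_iff, not_or]
    exact ⟨fun k => hav k.symm, fun k => hbv k.symm⟩)
  rwa [Function.update_of_ne (fun k => he.1 k.symm), Function.update_of_ne
    (fun k => he.2 k.symm)] at key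

variable [MetricSpace V] {s s' : State V}

open scoped Classical in
-- The expected new tree is certified by `mem_greedy_iff_of_indep`: it is independent, and any other
-- surviving edge, spanned by earlier edges of the old tree, remains spanned by earlier edges of the
-- new one once `v` is removed or contracted.
theorem CleanStep.cases_tree (hs : s.WellFormed) (hc : CleanStep s s') :
    s'.WellFormed ∧ s'.active = s.active ∧ s'.live.card < s.live.card ∧ ∃ v,
      ((s.tree.filter (fun e => v ∈ e)).card ≤ 1 ∧ s'.tree = s.tree.filter (fun e => v ∉ e)) ∨
      ∃ u₁ u₂, u₁ ≠ u₂ ∧ u₁ ≠ v ∧ u₂ ≠ v ∧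
        s.tree.filter (fun e => v ∈ e) = {s(v, u₁), s(v, u₂)} ∧
        s'.tree = insert s(u₁, u₂) (s.tree.filter (fun e => v ∉ e)) := by
  cases hc with
  | delete _ v hv hv' hd =>
    have hs' : (State.mk s.active (s.live.erase v)
        (s.perm.filter (fun e => v ∉ e))).WellFormed := by
      refine ⟨fun x hx => Finset.mem_erase.2 ⟨fun k => hv' (k ▸ hx), hs.active_subset hx⟩,
        hs.nodup.filter _, fun e => ?_⟩
      rw [List.mem_filter, hs.mem_perm]
      simp only [decide_eq_true_eq, Finset.mem_erase]
      constructor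
      · rintro ⟨⟨h1, h2⟩, h3⟩
        exact ⟨h1, fun x hx => ⟨fun k => h3 (k ▸ hx), h2 x hx⟩⟩
      · rintro ⟨h1, h2⟩
        exact ⟨⟨h1, fun x hx => (h2 x hx).2⟩, fun k => (h2 v k).1 rfl⟩
    refine ⟨hs', rfl, Finset.card_erase_lt_of_mem hv, v, Or.inl ⟨hd, ?_⟩⟩
    ext e
    rw [hs'.mem_tree]
    have hdeg : ∀ f ∈ s.tree, ∀ g ∈ s.tree, v ∈ f → v ∈ g → f = g := fun f hf g hg hvf hvg =>
      Finset.card_le_one.1 hd f (Finset.mem_filter.2 ⟨hf, hvf⟩) g (Finset.mem_filter.2 ⟨hg, hvg⟩)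
    refine mem_greedy_iff_of_indep (F := ((s.tree.filter (fun e => v ∉ e) : Finset _) : Set _))
      (hs.indep.mono (Finset.coe_subset.2 (Finset.filter_subset _ _))) ?_ ?_ e
    · intro e he
      have he := Finset.mem_filter.1 he
      exact List.mem_filter.2 ⟨hs.mem_perm_of_mem_tree he.1, by simpa using he.2⟩
    · intro e he heF
      obtain ⟨hep, hev⟩ := List.mem_filter.1 he
      have hev : v ∉ e := by simpa using hev
      have het : e ∉ s.tree := fun k => heF (Finset.mem_coe.2 (Finset.mem_filter.2 ⟨k, hev⟩))
      rw [preceding_filter (p := fun e => v ∉ e) hep hev]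
      have hsp : Spanned (preceding s.perm e) e := by
        by_contra k
        exact het (hs.mem_tree.2 (mem_greedy.2 ⟨hep, k⟩))
      have h1 := spanned_greedy_inter_preceding hep hsp
      rw [← hs.coe_tree] at h1
      refine (h1.remove_leaf (v := v) (fun f hf g hg => hdeg f hf.1 g hg.1) hev).mono ?_
      rintro f ⟨⟨h1, h2⟩, h3⟩
      exact ⟨Finset.mem_coe.2 (Finset.mem_filter.2 ⟨h1, h3⟩), h2, h3⟩
  | shortcut A L X Y v u₁ u₂ hv hv' hu hd h₁ h₂ =>
    set s : State V := State.mk A L (X ++ s(v, u₁) :: Y) with hsdef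
    have hu₁ : u₁ ≠ v := fun k => hs.not_isDiag h₁ (by simp [k])
    have hu₂ : u₂ ≠ v := fun k => hs.not_isDiag h₂ (by simp [k])
    have hu₁L : u₁ ∈ L := hs.within _ h₁ u₁ (by simp)
    have hu₂L : u₂ ∈ L := hs.within _ h₂ u₂ (by simp)
    have hvu : v ∉ s(u₁, u₂) := by simp [hu₁.symm, hu₂.symm]
    have hne : s(v, u₁) ≠ s(v, u₂) := fun k => hu (Sym2.congr_right.1 k)
    have hfil : s.tree.filter (fun e => v ∈ e) = {s(v, u₁), s(v, u₂)} := by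
      symm
      apply Finset.eq_of_subset_of_card_le
      · intro e he
        rcases Finset.mem_insert.1 he with rfl | he
        · exact Finset.mem_filter.2 ⟨h₁, by simp⟩
        · rw [Finset.mem_singleton.1 he]
          exact Finset.mem_filter.2 ⟨h₂, by simp⟩
      · rw [Finset.card_pair hne]
        exact hd.le
    have hdeg : ∀ f ∈ s.tree, v ∈ f → f = s(v, u₁) ∨ f = s(v, u₂) := by
      intro f hf hvf
      have : f ∈ s.tree.filter (fun e => v ∈ e) := Finset.mem_filter.2 ⟨hf, hvf⟩
      rw [hfil] at this
      simpa using this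
    -- Otherwise tree edges avoiding `v`, together with `s(v, u₁)`, would span `s(v, u₂)`.
    have hut : s(u₁, u₂) ∉ s.tree ∧
        ¬ Spanned ((s.tree.filter (fun e => v ∉ e) : Finset _) : Set (Sym2 V)) s(u₁, u₂) := by
      have h3 : ¬ Spanned ((s.tree.filter (fun e => v ∉ e) : Finset _) : Set (Sym2 V))
          s(u₁, u₂) := by
        intro k
        refine hs.indep _ h₂ ?_
        rw [spanned_mk] at k ⊢
        have k1 : Joined ((s.tree : Set (Sym2 V)) \ {s(v, u₂)}) v u₁ :=
          joined_of_mem ⟨h₁, hne⟩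
        refine k1.trans (k.mono ?_)
        intro f hf
        have hf := Finset.mem_filter.1 hf
        refine ⟨hf.1, fun k => hf.2 ?_⟩
        rw [Set.mem_singleton_iff.1 k]; simp
      exact ⟨fun k => h3 (spanned_of_mem (Finset.mem_coe.2 (Finset.mem_filter.2 ⟨k, hvu⟩))), h3⟩
    have hnd : (X ++ s(v, u₁) :: Y).Nodup := hs.nodup
    have hs' : (State.mk A (L.erase v) (X.filter (fun e => v ∉ e ∧ e ≠ s(u₁, u₂)) ++
          s(u₁, u₂) :: Y.filter (fun e => v ∉ e ∧ e ≠ s(u₁, u₂)))).WellFormed := by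
      refine ⟨fun x hx => Finset.mem_erase.2 ⟨fun k => hv' (k ▸ hx), hs.active_subset hx⟩,
        ?_, fun e => ?_⟩
      · rw [List.nodup_middle, List.nodup_cons, ← List.filter_append]
        refine ⟨?_, ?_⟩
        · intro k
          have := (List.mem_filter.1 k).2
          simp at this
        · exact (List.nodup_cons.1 (List.nodup_middle.1 hnd)).2.filter _
      · have hmem := hs.mem_perm e
        simp only [hsdef, List.mem_append, List.mem_cons] at hmem
        simp only [List.mem_append, List.mem_cons, List.mem_filter, decide_eq_true_eq,
          Finset.mem_erase]
        by_cases heu : e = s(u₁, u₂)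
        · subst heu
          simp [hu, hu₁, hu₂, hu₁L, hu₂L]
        · constructor
          · intro k
            have k1 : v ∉ e ∧ (e ∈ X ∨ e = s(v, u₁) ∨ e ∈ Y) := by tauto
            refine ⟨(hmem.1 k1.2).1, fun x hx => ⟨fun hxv => k1.1 (hxv ▸ hx),
              (hmem.1 k1.2).2 x hx⟩⟩
          · rintro ⟨k1, k2⟩
            have hve : v ∉ e := fun k => (k2 v k).1 rfl
            have hev : e ≠ s(v, u₁) := by rintro rfl; simp at hve
            have := hmem.2 ⟨k1, fun x hx => (k2 x hx).2⟩
            tauto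
    refine ⟨hs', rfl, Finset.card_erase_lt_of_mem hv, v, Or.inr ⟨u₁, u₂, hu, hu₁, hu₂, hfil, ?_⟩⟩
    ext e
    rw [hs'.mem_tree]
    refine mem_greedy_iff_of_indep
      (F := ((insert s(u₁, u₂) (s.tree.filter (fun e => v ∉ e)) : Finset _) : Set _)) ?_ ?_ ?_ e
    · rw [Finset.coe_insert]
      exact (hs.indep.mono (Finset.coe_subset.2 (Finset.filter_subset _ _))).insert_of_not_spanned
        hut.2
    · intro f hf
      rcases Finset.mem_insert.1 (Finset.mem_coe.1 hf) with rfl | hf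
      · simp
      · obtain ⟨hft, hvf⟩ := Finset.mem_filter.1 hf
        have hfu : f ≠ s(u₁, u₂) := fun k => hut.1 (k ▸ hft)
        have hfv : f ≠ s(v, u₁) := by rintro rfl; simp at hvf
        have := hs.mem_perm_of_mem_tree hft
        simp only [hsdef, List.mem_append, List.mem_cons] at this
        simp only [List.mem_append, List.mem_cons, List.mem_filter, decide_eq_true_eq]
        rcases this with k | k | k
        exacts [Or.inl ⟨k, hvf, hfu⟩, absurd k hfv, Or.inr (Or.inr ⟨k, hvf, hfu⟩)]
    · intro e he heF
      have heu : e ≠ s(u₁, u₂) := by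
        rintro rfl; exact heF (Finset.mem_coe.2 (Finset.mem_insert_self _ _))
      simp only [List.mem_append, List.mem_cons, List.mem_filter, decide_eq_true_eq] at he
      have he' : (e ∈ X ∨ e ∈ Y) ∧ v ∉ e := by
        rcases he with k | k | k
        exacts [⟨Or.inl k.1, k.2.1⟩, absurd k heu, ⟨Or.inr k.1, k.2.1⟩]
      have hve : v ∉ e := he'.2
      have het : e ∉ s.tree := fun k => heF (Finset.mem_coe.2
        (Finset.mem_insert_of_mem (Finset.mem_filter.2 ⟨k, hve⟩)))
      have hep : e ∈ s.perm := by
        simp only [hsdef, List.mem_append, List.mem_cons]; exact he'.1.imp_right Or.inr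
      have hsp : Spanned (preceding s.perm e) e := by
        by_contra k
        exact het (hs.mem_tree.2 (mem_greedy.2 ⟨hep, k⟩))
      have h1 := spanned_greedy_inter_preceding hep hsp
      rw [← hs.coe_tree] at h1
      have hF : ∀ f ∈ s.tree, v ∉ f → f ∈ ((insert s(u₁, u₂)
          (s.tree.filter (fun e => v ∉ e)) : Finset _) : Set (Sym2 V)) ∧ f ≠ s(u₁, u₂) :=
        fun f hf hvf => ⟨Finset.mem_coe.2 (Finset.mem_insert_of_mem (Finset.mem_filter.2
          ⟨hf, hvf⟩)), fun k => hut.1 (k ▸ hf)⟩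
      have hpe : v ∉ e ∧ e ≠ s(u₁, u₂) := ⟨hve, heu⟩
      have hXY : e ∈ X ∨ e ∈ Y := he'.1
      -- Before the position of `s(v, u₁)` the only tree edge at `v` can be `s(v, u₂)`, so `v` is a
      -- leaf and can be dropped. After it, `s(u₁, u₂)` already precedes `e` and contraction works.
      -- This is why the shortcut must take the position of a tree edge at `v`.
      rcases hXY with heX | heY
      · obtain ⟨X₁, X₂, rfl, heX₁⟩ := exists_eq_append_of_mem heX
        have h2 : preceding s.perm e = {x | x ∈ X₁} := by
          simp only [hsdef, List.append_assoc, List.cons_append]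
          exact preceding_append heX₁
        rw [h2] at h1
        rw [List.filter_append, List.filter_cons_of_pos (by simpa using hpe), List.append_assoc,
          List.cons_append, preceding_append (fun k => heX₁ (List.mem_filter.1 k).1)]
        have hv1 : s(v, u₁) ∉ X₁ := by
          intro k
          have := (List.nodup_cons.1 (List.nodup_middle.1 hnd)).1
          exact this (by simp [k])
        refine (h1.remove_leaf (v := v) ?_ hve).mono ?_
        · have aux : ∀ f ∈ (s.tree : Set (Sym2 V)) ∩ {x | x ∈ X₁}, v ∈ f → f = s(v, u₂) :=
            fun f hf hvf => (hdeg f hf.1 hvf).resolve_left fun k => hv1 (k ▸ hf.2)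
          exact fun f hf g hg hvf hvg => (aux f hf hvf).trans (aux g hg hvg).symm
        · rintro f ⟨⟨h3, h4⟩, h5⟩
          have := hF f h3 h5
          exact ⟨this.1, List.mem_filter.2 ⟨h4, by simpa using ⟨h5, this.2⟩⟩⟩
      · obtain ⟨Y₁, Y₂, rfl, heY₁⟩ := exists_eq_append_of_mem heY
        have hnd' := hnd
        rw [← List.cons_append, ← List.append_assoc] at hnd'
        have he1 : e ∉ X ++ s(v, u₁) :: Y₁ := fun k =>
          (List.nodup_cons.1 (List.nodup_middle.1 hnd')).1 (List.mem_append_left _ k)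
        have h2 : preceding s.perm e = {x | x ∈ X ++ s(v, u₁) :: Y₁} := by
          have : s.perm = (X ++ s(v, u₁) :: Y₁) ++ e :: Y₂ := by simp [hsdef]
          rw [this, preceding_append he1]
        have he2 : e ∉ X.filter (fun e => v ∉ e ∧ e ≠ s(u₁, u₂)) ++
            s(u₁, u₂) :: Y₁.filter (fun e => v ∉ e ∧ e ≠ s(u₁, u₂)) := by
          simp only [List.mem_append, List.mem_cons, List.mem_filter]
          simp only [List.mem_append, List.mem_cons] at he1
          rintro (k | k | k)
          exacts [he1 (Or.inl k.1), heu k, he1 (Or.inr (Or.inr k.1))]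
        rw [h2] at h1
        rw [List.filter_append, List.filter_cons_of_pos (by simpa using hpe),
          ← List.cons_append, ← List.append_assoc, preceding_append he2]
        refine h1.shortcut (fun f hf => hdeg f hf.1) hu₁ hu₂ ?_ ?_ hve
        · rintro f ⟨h3, h4⟩ h5
          have := hF f h3 h5
          refine ⟨this.1, ?_⟩
          have hfv : f ≠ s(v, u₁) := by rintro rfl; simp at h5
          simp only [Set.mem_ofPred_eq, List.mem_append, List.mem_cons, List.mem_filter,
            decide_eq_true_eq] at h4 ⊢
          rcases h4 with k | k | k
          · exact Or.inl ⟨k, h5, this.2⟩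
          · exact absurd k hfv
          · exact Or.inr (Or.inr ⟨k, h5, this.2⟩)
        · exact ⟨Finset.mem_coe.2 (Finset.mem_insert_self _ _), by simp⟩

end Clean

/-! ### Reading a request -/

section Read

variable {V : Type*} {S : Set (Sym2 V)} {s s' : State V} {r : Request V}

theorem greedy_eq_nil {l : List (Sym2 V)} (h : ∀ e ∈ l, Spanned S e) : greedy S l = [] := by
  rw [List.eq_nil_iff_forall_not_mem]
  exact fun e he => (mem_of_mem_greedy he).2 (h e (mem_of_mem_greedy he).1)

/-- Once one edge is kept, it spans all later ones together with `S`. -/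
theorem length_greedy_le_one {l : List (Sym2 V)}
    (h : ∀ e ∈ l, ∀ f ∈ l, Spanned (insert e S) f) : (greedy S l).length ≤ 1 := by
  induction l generalizing S with
  | nil => simp [greedy]
  | cons a l ih =>
    by_cases hs : Spanned S a
    · rw [greedy_cons_of_spanned hs]
      refine ih fun e he f hf => ?_
      exact (h e (by simp [he]) f (by simp [hf])).mono
        (Set.insert_subset_insert (Set.subset_insert _ _))
    · rw [greedy_cons_of_not_spanned hs, greedy_eq_nil fun e he => h a (by simp) e (by simp [he])]
      simp

theorem ReadRequest.wellFormed (hs : s.WellFormed) (hr : ReadRequest s r s') :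
    s'.WellFormed := by
  classical
  cases hr with
  | arriveNew v E hv hE hmem =>
    refine ⟨?_, ?_, fun e => ?_⟩
    · intro x hx
      rcases Finset.mem_insert.1 hx with rfl | hx
      · exact Finset.mem_insert_self _ _
      · exact Finset.mem_insert_of_mem (hs.active_subset hx)
    · refine hs.nodup.append hE fun e he he' => ?_
      obtain ⟨w, -, rfl⟩ := (hmem e).1 he'
      exact hv (((hs.mem_perm _).1 he).2 v (by simp))
    · rw [List.mem_append, hs.mem_perm, hmem]
      induction e with | h x y
      simp only [Sym2.mem_iff, Finset.mem_insert, forall_eq_or_imp, forall_eq,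
        Sym2.mk_isDiag_iff]
      constructor
      · rintro (⟨h1, h2, h3⟩ | ⟨w, hw, h⟩)
        · exact ⟨h1, Or.inr h2, Or.inr h3⟩
        · rcases Sym2.eq_iff.1 h with ⟨rfl, rfl⟩ | ⟨rfl, rfl⟩
          · exact ⟨fun k => hv (k ▸ hw), Or.inl rfl, Or.inr hw⟩
          · exact ⟨fun k => hv (k ▸ hw), Or.inr hw, Or.inl rfl⟩
      · rintro ⟨h1, rfl | h2, rfl | h3⟩
        · exact absurd rfl h1
        · exact Or.inr ⟨y, h3, rfl⟩
        · exact Or.inr ⟨x, h2, Sym2.eq_swap⟩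
        · exact Or.inl ⟨h1, h2, h3⟩
  | arriveLive v hv =>
    refine ⟨?_, hs.nodup, hs.mem_perm⟩
    intro x hx
    rcases Finset.mem_insert.1 hx with rfl | hx
    exacts [hv, hs.active_subset hx]
  | depart v =>
    exact ⟨(Finset.erase_subset _ _).trans hs.active_subset, hs.nodup, hs.mem_perm⟩

open scoped Classical in
-- New edges are appended at the end, so the old tree survives. The old live vertices are already
-- joined, so one edge at the new vertex spans all its others.
theorem ReadRequest.tree [MetricSpace V] (hs : s.WellFormed) (hr : ReadRequest s r s') :
    s.tree ⊆ s'.tree ∧ (s'.tree \ s.tree).card ≤ 1 := by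
  have hs' := hr.wellFormed hs
  cases hr with
  | arriveNew v E hv hE hmem =>
    constructor
    · intro e he
      rw [hs'.mem_tree, greedy_append]
      exact List.mem_append_left _ (hs.mem_tree.1 he)
    · have h1 : (greedy {x | x ∈ s.perm} E).length ≤ 1 := by
        refine length_greedy_le_one fun e he f hf => ?_
        obtain ⟨w, hw, rfl⟩ := (hmem e).1 he
        obtain ⟨w', hw', rfl⟩ := (hmem f).1 hf
        rw [spanned_mk]
        exact (joined_of_mem (Set.mem_insert _ _)).trans
          ((hs.joined_perm hw hw').mono (Set.subset_insert _ _))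
      refine le_trans (Finset.card_le_card ?_)
        ((List.toFinset_card_le (greedy {x | x ∈ s.perm} E)).trans h1)
      intro e he
      obtain ⟨h2, h3⟩ := Finset.mem_sdiff.1 he
      rw [hs'.mem_tree, greedy_append, List.mem_append, ← hs.mem_tree, Set.empty_union] at h2
      exact List.mem_toFinset.2 (h2.resolve_left h3)
  | arriveLive v hv =>
    have : (State.mk (insert v s.active) s.live s.perm).tree = s.tree := rfl
    rw [this]; simp
  | depart v =>
    have : (State.mk (s.active.erase v) s.live s.perm).tree = s.tree := rfl
    rw [this]; simp

end Read

/-! ## Termination -/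

section Termination

variable {V : Type*} [MetricSpace V] {γ : ℝ} {s s' : State V} {r : Request V}

theorem Step.wellFormed (hγ : 1 < γ) (hs : s.WellFormed) (h : Step γ s s') :
    s'.WellFormed ∧ s'.active = s.active ∧ s'.live.card ≤ s.live.card := by
  rcases h with h | ⟨-, h⟩
  · obtain ⟨h1, h2, h3, -⟩ := h.cases_tree hs
    exact ⟨h1, h2, h3.le⟩
  · obtain ⟨h1, h2, h3, -⟩ := h.cases_tree hγ hs
    exact ⟨h1, h2, h3 ▸ le_rfl⟩

theorem State.WellFormed.of_sequence (hγ : 1 < γ) {x : ℕ → State V} (h0 : (x 0).WellFormed)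
    (hx : ∀ n, Step γ (x n) (x (n + 1))) (n : ℕ) :
    (x n).WellFormed ∧ (x n).live.card ≤ (x 0).live.card := by
  induction n with
  | zero => exact ⟨h0, le_rfl⟩
  | succ n ih =>
    obtain ⟨h1, -, h2⟩ := (hx n).wellFormed hγ ih.1
    exact ⟨h1, h2.trans ih.2⟩

/-- There is no infinite sequence of local moves: the pair of cost and delay of the solution
decreases lexicographically, while the permutations range over a finite set. -/
theorem not_forall_localMove (hγ : 1 < γ) {x : ℕ → State V} (hwf : ∀ n, (x n).WellFormed)
    (hx : ∀ n, LocalMove γ (x n) (x (n + 1))) : False := by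
  classical
  have hst := fun n => (hx n).cases_tree hγ (hwf n)
  have hactive : ∀ n, (x n).active = (x 0).active := by
    intro n
    induction n with
    | zero => rfl
    | succ n ih => rw [(hst n).2.1, ih]
  have hlive : ∀ n, (x n).live = (x 0).live := by
    intro n
    induction n with
    | zero => rfl
    | succ n ih => rw [(hst n).2.2.1, ih]
  have hperm : ∀ n, (x n).perm.Perm (x 0).perm := by
    intro n
    induction n with
    | zero => exact List.Perm.refl _
    | succ n ih => exact (hst n).2.2.2.1.trans ih
  let key : State V → ℝ ×ₗ ℝ := fun s =>
    toLex (cost s.tree, delay (treeDensity s.tree) s.perm)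
  have hanti : StrictAnti fun n => key (x n) := by
    apply strictAnti_nat_of_succ_lt
    intro n
    rw [Prod.Lex.lt_iff]
    rcases (hst n).2.2.2.2 with ⟨h1, h2⟩ | ⟨b, hb, u, hud, hu, ht, hub⟩
    · exact Or.inr ⟨by simp [key, h1], by simpa [key, h1] using h2⟩
    · left
      have h1 : u ∉ (x n).tree.erase b := fun k => hu (Finset.mem_of_mem_erase k)
      have h2 := Finset.sum_erase_add (x n).tree edgeCost hb
      have h3 := edgeCost_pos hud
      simp only [key, cost, ht, ofLex_toLex]
      rw [Finset.sum_insert h1]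
      nlinarith
  -- Active and live sets stay constant, so the permutation determines the state.
  have hinj : Function.Injective fun n => (⟨(x n).perm, List.mem_permutations.2 (hperm n)⟩ :
      {l // l ∈ (x 0).perm.permutations}) := by
    intro m n hmn
    apply hanti.injective
    have h1 : (x m).perm = (x n).perm := congrArg Subtype.val hmn
    have h2 : x m = x n := by
      cases hm : x m
      cases hn : x n
      have h3 := (hactive m).trans (hactive n).symm
      have h4 := (hlive m).trans (hlive n).symm
      rw [hm, hn] at h1 h3 h4
      simp_all
    simp only [h2]
  have hfin : Finite {l // l ∈ (x 0).perm.permutations} :=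
    Set.Finite.to_subtype (List.finite_toSet _)
  exact not_injective_infinite_finite _ hinj

/-- Induction on the number of live vertices: restart the sequence after a clean step; if there is
none, only local moves remain. -/
theorem not_forall_step (hγ : 1 < γ) {x : ℕ → State V} (h0 : (x 0).WellFormed)
    (hx : ∀ n, Step γ (x n) (x (n + 1))) : False := by
  induction hk : (x 0).live.card using Nat.strong_induction_on generalizing x with
  | _ k ih =>
    have hwf := State.WellFormed.of_sequence hγ h0 hx
    by_cases hc : ∃ n, CleanStep (x n) (x (n + 1))
    · obtain ⟨n, hn⟩ := hc
      have h1 := (hn.cases_tree (hwf n).1).2.2.1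
      refine ih _ ?_ (x := fun m => x (n + 1 + m)) (hwf (n + 1)).1 (fun m => hx _) rfl
      rw [← hk]
      exact h1.trans_le (hwf n).2
    · exact not_forall_localMove hγ (fun n => (hwf n).1) fun n =>
        ((hx n).resolve_left fun k => hc ⟨n, k⟩).2

theorem exists_terminal (hγ : 1 < γ) (hs : s.WellFormed) :
    ∃ s', Relation.ReflTransGen (Step γ) s s' ∧ ¬ ∃ s₁, Step γ s' s₁ := by
  by_contra hcon
  push Not at hcon
  choose! g hg using hcon
  have hreach : ∀ n, Relation.ReflTransGen (Step γ) s (g^[n] s) := by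
    intro n
    induction n with
    | zero => exact Relation.ReflTransGen.refl
    | succ n ih =>
      rw [Function.iterate_succ_apply']
      exact ih.tail (hg _ ih)
  refine not_forall_step hγ (x := fun n => g^[n] s) hs fun n => ?_
  simp only [Function.iterate_succ_apply']
  exact hg _ (hreach n)

theorem exists_readRequest {V : Type*} (s : State V) (r : Request V) :
    ∃ s', ReadRequest s r s' := by
  classical
  cases r with
  | arrive v =>
    by_cases hv : v ∈ s.live
    · exact ⟨_, ReadRequest.arriveLive s v hv⟩
    · refine ⟨_, ReadRequest.arriveNew s v (s.live.image fun w => s(v, w)).toList hv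
        (Finset.nodup_toList _) fun e => ?_⟩
      simp only [Finset.mem_toList, Finset.mem_image, eq_comm]
  | depart v => exact ⟨_, ReadRequest.depart s v⟩

theorem exists_update (hγ : 1 < γ) (hs : s.WellFormed) (r : Request V) :
    ∃ s', Update γ s r s' := by
  obtain ⟨s₀, h₀⟩ := exists_readRequest s r
  obtain ⟨s', h1, h2⟩ := exists_terminal hγ (h₀.wellFormed hs)
  exact ⟨s', s₀, h₀, h1, h2⟩

theorem wellFormed_of_reflTransGen (hγ : 1 < γ) (hs : s.WellFormed)
    (h : Relation.ReflTransGen (Step γ) s s') : s'.WellFormed ∧ s'.active = s.active := by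
  induction h with
  | refl => exact ⟨hs, rfl⟩
  | tail _ hbc ih =>
    obtain ⟨h1, h2, -⟩ := hbc.wellFormed hγ ih.1
    exact ⟨h1, h2.trans ih.2⟩

theorem ReadRequest.active_eq {V : Type*} {s s' : State V} {r : Request V} {σ : List (Request V)}
    (hs : s.active = activeSet σ) (h : ReadRequest s r s') : s'.active = activeSet (r :: σ) := by
  cases h <;> simp [activeSet, hs]

theorem Update.invariant (hγ : 1 < γ) {σ : List (Request V)} (hs : s.WellFormed)
    (ha : s.active = activeSet σ) (h : Update γ s r s') :
    s'.WellFormed ∧ s'.active = activeSet (r :: σ) := by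
  obtain ⟨s₀, h₀, h1, -⟩ := h
  obtain ⟨h2, h3⟩ := wellFormed_of_reflTransGen hγ (h₀.wellFormed hs) h1
  exact ⟨h2, h3.trans (h₀.active_eq ha)⟩

theorem wellFormed_empty {V : Type*} : (State.mk (∅ : Finset V) ∅ []).WellFormed := by
  refine ⟨subset_rfl, List.nodup_nil, fun e => ?_⟩
  induction e with | h x y
  exact ⟨fun h => absurd h List.not_mem_nil, fun h =>
    absurd (h.2 x (Sym2.mem_mk_left x y)) (Finset.notMem_empty x)⟩

theorem Legal.of_cons {V : Type*} {r : Request V} {σ : List (Request V)}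
    (h : Legal (r :: σ)) : Legal σ := by
  cases r <;> exact h.1

open scoped Classical in
/-- Some deterministic execution of the local search. -/
noncomputable def search (V : Type*) [MetricSpace V] (γ : ℝ) : List (Request V) → State V
  | [] => ⟨∅, ∅, []⟩
  -- The default is not reached after legal histories when `1 < γ`: the state is then well-formed
  -- and has an update.
  | r :: σ => if h : ∃ s', Update γ (search V γ σ) r s' then h.choose else search V γ σ

theorem isLocalSearch_search (hγ : 1 < γ) : IsLocalSearch γ (search V γ) := by
  have hu : ∀ {σ : List (Request V)} {r}, (search V γ σ).WellFormed →
      Update γ (search V γ σ) r (search V γ (r :: σ)) := by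
    intro σ r h
    have h1 := exists_update hγ h r
    rw [search, dif_pos h1]
    exact h1.choose_spec
  have key : ∀ σ : List (Request V), Legal σ →
      (search V γ σ).WellFormed ∧ (search V γ σ).active = activeSet σ := by
    intro σ
    induction σ with
    | nil => exact fun _ => ⟨wellFormed_empty, rfl⟩
    | cons r σ ih =>
      intro h
      obtain ⟨h1, h2⟩ := ih h.of_cons
      exact (hu h1).invariant hγ h1 h2
  exact ⟨rfl, fun r σ h => hu (key σ h.of_cons).1⟩

theorem IsLocalSearch.invariant (hγ : 1 < γ) {S : List (Request V) → State V}
    (hS : IsLocalSearch γ S) (σ : List (Request V)) (h : Legal σ) :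
    (S σ).WellFormed ∧ (S σ).active = activeSet σ := by
  induction σ with
  | nil => rw [hS.1]; exact ⟨wellFormed_empty, rfl⟩
  | cons r σ ih =>
    obtain ⟨h1, h2⟩ := ih h.of_cons
    exact (hS.2 r σ h).invariant hγ h1 h2

theorem IsLocalSearch.alwaysTerminates (hγ : 1 < γ) {S : List (Request V) → State V}
    (hS : IsLocalSearch γ S) : AlwaysTerminates γ S := by
  rintro r σ h ⟨x, hx0, hx⟩
  exact not_forall_step hγ (hx0.wellFormed (hS.invariant hγ σ h.of_cons).1) hx

theorem IsLocalSearch.isFeasible (hγ : 1 < γ) {S : List (Request V) → State V}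
    (hS : IsLocalSearch γ S) : IsFeasible (outputOf S) := by
  intro σ h
  obtain ⟨h1, h2⟩ := hS.invariant hγ σ h
  rw [← h2]
  exact h1.isSteinerTree

end Termination

/-! ## Recourse -/

section Recourse

theorem card_symmDiff_le_of_subset {α : Type*} [DecidableEq α] {T T' R : Finset α} (h : T \ T' ⊆ R)
    (h' : T' \ T ⊆ R) :
    (symmDiff T' T).card ≤ R.card :=
  Finset.card_le_card (Finset.union_subset h' h)

theorem card_symmDiff_triangle {α : Type*} [DecidableEq α] (A B C : Finset α) :
    (symmDiff A C).card ≤ (symmDiff A B).card + (symmDiff B C).card := by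
  refine (Finset.card_le_card ?_).trans (Finset.card_union_le _ _)
  exact symmDiff_triangle A B C

variable {V : Type*} [MetricSpace V] {s s' : State V} {r : Request V} {dmin dmax : ℝ}
  {e : Sym2 V}

/-- The weight of an edge in the potential. -/
noncomputable def edgePotential (dmin : ℝ) (e : Sym2 V) : ℝ := 1 + Real.log (edgeCost e / dmin)

/-- The constant 1 in the weight of an edge pays for deletions and shortcuts, the logarithm for
exchanges. -/
noncomputable def potential (dmin : ℝ) (s : State V) : ℝ := ∑ e ∈ s.tree, edgePotential dmin e

theorem edgeCost_mem_distances (h : ¬ e.IsDiag) : edgeCost e ∈ distances V := by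
  induction e with | h x y
  exact ⟨x, y, by simpa using h, rfl⟩

theorem one_le_edgePotential (h0 : 0 < dmin) (hmin : IsGLB (distances V) dmin)
    (h : ¬ e.IsDiag) : 1 ≤ edgePotential dmin e := by
  have h1 : 1 ≤ edgeCost e / dmin := (one_le_div h0).2 (hmin.1 (edgeCost_mem_distances h))
  have := Real.log_nonneg h1
  unfold edgePotential
  linarith

theorem edgePotential_le (h0 : 0 < dmin) (hmax : IsLUB (distances V) dmax) (h : ¬ e.IsDiag) :
    edgePotential dmin e ≤ 1 + Real.log (dmax / dmin) := by
  have h1 : edgeCost e / dmin ≤ dmax / dmin :=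
    div_le_div_of_nonneg_right (hmax.1 (edgeCost_mem_distances h)) h0.le
  have := Real.log_le_log (div_pos (edgeCost_pos h) h0) h1
  unfold edgePotential
  linarith

/-- In units of `dmin` the two old lengths satisfy `a, b ≥ 1`, so the new one is at most `a + b ≤
2ab`. One constant 1 is freed and at most `log 2 < 7/10` is lost. -/
theorem edgePotential_shortcut (h0 : 0 < dmin) (hmin : IsGLB (distances V) dmin) {v u₁ u₂ : V}
    (hu : u₁ ≠ u₂) (hu₁ : u₁ ≠ v) (hu₂ : u₂ ≠ v) :
    edgePotential dmin s(u₁, u₂) + 3 / 10 ≤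
      edgePotential dmin s(v, u₁) + edgePotential dmin s(v, u₂) := by
  have ha : 1 ≤ dist v u₁ / dmin := (one_le_div h0).2 (hmin.1 ⟨v, u₁, hu₁.symm, rfl⟩)
  have hb : 1 ≤ dist v u₂ / dmin := (one_le_div h0).2 (hmin.1 ⟨v, u₂, hu₂.symm, rfl⟩)
  have hc : dist u₁ u₂ / dmin ≤ dist v u₁ / dmin + dist v u₂ / dmin := by
    rw [← add_div]
    refine div_le_div_of_nonneg_right ?_ h0.le
    rw [dist_comm v u₁]
    exact dist_triangle _ _ _
  have hc0 : 0 < dist u₁ u₂ / dmin := div_pos (dist_pos.2 hu) h0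
  simp only [edgePotential, edgeCost_mk]
  set a := dist v u₁ / dmin
  set b := dist v u₂ / dmin
  have h1 : Real.log (dist u₁ u₂ / dmin) ≤ Real.log (2 * (a * b)) :=
    Real.log_le_log hc0 (by nlinarith)
  rw [Real.log_mul (by norm_num) (by positivity), Real.log_mul (by positivity)
    (by positivity)] at h1
  have := Real.log_two_lt_d9
  linarith


open scoped Classical in
/-- The recourse of each step is paid for by the potential. -/
theorem Step.recourse (h0 : 0 < dmin) (hmin : IsGLB (distances V) dmin) (hs : s.WellFormed)
    (h : Step (Real.exp 2) s s') :
    ((symmDiff s'.tree s.tree).card : ℝ) ≤ 10 * (potential dmin s - potential dmin s') := by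
  have hpos : ∀ e ∈ s.tree, 1 ≤ edgePotential dmin e :=
    fun e he => one_le_edgePotential h0 hmin (hs.not_isDiag he)
  rcases h with h | ⟨-, h⟩
  · obtain ⟨-, -, -, v, ⟨-, h2⟩ | ⟨u₁, u₂, hu, hu₁, hu₂, hfil, h2⟩⟩ := h.cases_tree hs
    · have h3 := Finset.sum_filter_add_sum_filter_not s.tree (fun e => v ∈ e)
        (edgePotential dmin)
      have h4 : ((s.tree.filter (fun e => v ∈ e)).card : ℝ) ≤
          ∑ e ∈ s.tree.filter (fun e => v ∈ e), edgePotential dmin e := by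
        rw [Finset.cast_card]
        exact Finset.sum_le_sum fun e he => hpos e (Finset.mem_filter.1 he).1
      have h5 : (symmDiff s'.tree s.tree).card ≤ (s.tree.filter (fun e => v ∈ e)).card := by
        apply card_symmDiff_le_of_subset
        · intro e he
          rw [h2, Finset.mem_sdiff, Finset.mem_filter] at he
          rw [Finset.mem_filter]; tauto
        · intro e he
          rw [h2, Finset.mem_sdiff, Finset.mem_filter] at he
          tauto
      have h6 : ((symmDiff s'.tree s.tree).card : ℝ) ≤ (s.tree.filter (fun e => v ∈ e)).card := by
        exact_mod_cast h5
      have h7 : (0 : ℝ) ≤ (s.tree.filter (fun e => v ∈ e)).card := Nat.cast_nonneg _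
      simp only [potential, h2]
      rw [h2] at h6
      linarith
    · have h3 := Finset.sum_filter_add_sum_filter_not s.tree (fun e => v ∈ e)
        (edgePotential dmin)
      have hne : s(v, u₁) ≠ s(v, u₂) := fun k => hu (Sym2.congr_right.1 k)
      rw [hfil, Finset.sum_pair hne] at h3
      have h4 : potential dmin s' ≤ edgePotential dmin s(u₁, u₂) +
          ∑ e ∈ s.tree.filter (fun e => v ∉ e), edgePotential dmin e := by
        rw [potential, h2]
        by_cases hm : s(u₁, u₂) ∈ s.tree.filter (fun e => v ∉ e)
        · rw [Finset.insert_eq_of_mem hm]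
          linarith [hpos _ (Finset.mem_filter.1 hm).1]
        · rw [Finset.sum_insert hm]
      have h5 : (symmDiff s'.tree s.tree).card ≤
          ({s(u₁, u₂), s(v, u₁), s(v, u₂)} : Finset (Sym2 V)).card := by
        apply card_symmDiff_le_of_subset
        · intro e he
          rw [h2, Finset.mem_sdiff, Finset.mem_insert, Finset.mem_filter] at he
          have : e ∈ s.tree.filter (fun e => v ∈ e) := by
            rw [Finset.mem_filter]; tauto
          rw [hfil] at this
          exact Finset.mem_insert_of_mem this
        · intro e he
          rw [h2, Finset.mem_sdiff, Finset.mem_insert, Finset.mem_filter] at he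
          rw [Finset.mem_insert]; tauto
      -- Three changed edges against a drop of `3/10`: this case fixes the factor 10.
      have h6 : ((symmDiff s'.tree s.tree).card : ℝ) ≤ 3 := by
        exact_mod_cast h5.trans Finset.card_le_three
      have h7 := edgePotential_shortcut h0 hmin hu hu₁ hu₂
      have h8 : potential dmin s = ∑ e ∈ s.tree, edgePotential dmin e := rfl
      linarith
  · have hγ : (1 : ℝ) < Real.exp 2 := Real.one_lt_exp_iff.2 (by norm_num)
    obtain ⟨-, -, -, -, ⟨h1, -⟩ | ⟨b, hb, u, hud, hu, ht, hub⟩⟩ := h.cases_tree hγ hs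
    · simp [potential, h1]
    · have h1 : u ∉ s.tree.erase b := fun k => hu (Finset.mem_of_mem_erase k)
      have h2 := Finset.sum_erase_add s.tree (edgePotential dmin) hb
      have h3 : (symmDiff s'.tree s.tree).card ≤ ({u, b} : Finset (Sym2 V)).card := by
        apply card_symmDiff_le_of_subset
        · intro e he
          rw [ht, Finset.mem_sdiff, Finset.mem_insert, Finset.mem_erase] at he
          rw [Finset.mem_insert, Finset.mem_singleton]; tauto
        · intro e he
          rw [ht, Finset.mem_sdiff, Finset.mem_insert, Finset.mem_erase] at he
          rw [Finset.mem_insert]; tauto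
      have h4 : ((symmDiff s'.tree s.tree).card : ℝ) ≤ 2 := by
        exact_mod_cast h3.trans Finset.card_le_two
      have hu0 := edgeCost_pos hud
      -- The choice `γ = e²` makes the logarithm fall by 2.
      have h5 : edgePotential dmin u + 2 ≤ edgePotential dmin b := by
        have h6 : Real.exp 2 * (edgeCost u / dmin) ≤ edgeCost b / dmin := by
          rw [← mul_div_assoc]
          exact div_le_div_of_nonneg_right hub h0.le
        have h7 := Real.log_le_log (by positivity) h6
        rw [Real.log_mul (by positivity) (by positivity), Real.log_exp] at h7
        unfold edgePotential
        linarith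
      have h6 : potential dmin s' = edgePotential dmin u +
          ∑ e ∈ s.tree.erase b, edgePotential dmin e := by
        rw [potential, ht, Finset.sum_insert h1]
      have h7 : potential dmin s = ∑ e ∈ s.tree, edgePotential dmin e := rfl
      linarith

open scoped Classical in
-- In the constant 11, 10 pays for the potential of the edge inserted on reading the request and 1
-- for its insertion.
theorem Update.recourse (h0 : 0 < dmin) (hmin : IsGLB (distances V) dmin)
    (hmax : IsLUB (distances V) dmax) (hs : s.WellFormed) (h : Update (Real.exp 2) s r s') :
    ((symmDiff s'.tree s.tree).card : ℝ) ≤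
      10 * (potential dmin s - potential dmin s') + 11 * (1 + Real.log (dmax / dmin)) := by
  have hγ : (1 : ℝ) < Real.exp 2 := Real.one_lt_exp_iff.2 (by norm_num)
  obtain ⟨s₀, h₀, h1, -⟩ := h
  have hs₀ := h₀.wellFormed hs
  have h2 : ((symmDiff s'.tree s₀.tree).card : ℝ) ≤
      10 * (potential dmin s₀ - potential dmin s') := by
    induction h1 with
    | refl => simp
    | @tail b c hab hbc ih =>
      have h3 := hbc.recourse h0 hmin (wellFormed_of_reflTransGen hγ hs₀ hab).1
      have h4 : ((symmDiff c.tree s₀.tree).card : ℝ) ≤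
          (symmDiff c.tree b.tree).card + (symmDiff b.tree s₀.tree).card := by
        exact_mod_cast card_symmDiff_triangle c.tree b.tree s₀.tree
      linarith
  obtain ⟨h3, h4⟩ := h₀.tree hs
  have h5 : ((symmDiff s'.tree s.tree).card : ℝ) ≤
      (symmDiff s'.tree s₀.tree).card + (symmDiff s₀.tree s.tree).card := by
    exact_mod_cast card_symmDiff_triangle s'.tree s₀.tree s.tree
  have h6 : (symmDiff s₀.tree s.tree).card ≤ 1 := by
    refine le_trans (Finset.card_le_card ?_) h4
    exact Finset.union_subset subset_rfl (by simp [Finset.sdiff_eq_empty_iff_subset.2 h3])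
  have h6' : ((symmDiff s₀.tree s.tree).card : ℝ) ≤ 1 := by exact_mod_cast h6
  have hlog : 0 ≤ Real.log (dmax / dmin) := by
    -- The empty set has no greatest lower bound in `ℝ`, so there are two distinct points.
    have hne : (distances V).Nonempty := hmin.nonempty
    obtain ⟨d, hd⟩ := hne
    exact Real.log_nonneg ((one_le_div h0).2 ((hmin.1 hd).trans (hmax.1 hd)))
  have h7 : potential dmin s₀ ≤ potential dmin s + (1 + Real.log (dmax / dmin)) := by
    have h8 := Finset.sum_sdiff (f := edgePotential dmin) h3
    have h9 : ∑ e ∈ s₀.tree \ s.tree, edgePotential dmin e ≤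
        (s₀.tree \ s.tree).card • (1 + Real.log (dmax / dmin)) :=
      Finset.sum_le_card_nsmul _ _ _ fun e he =>
        edgePotential_le h0 hmax (hs₀.not_isDiag (Finset.mem_sdiff.1 he).1)
    rw [nsmul_eq_mul] at h9
    have h10 : ((s₀.tree \ s.tree).card : ℝ) ≤ 1 := by exact_mod_cast h4
    unfold potential
    nlinarith
  linarith

/-- The potential starts at 0 and stays nonnegative, so the bounds per update telescope. -/
theorem IsLocalSearch.hasAmortizedRecourse (h0 : 0 < dmin) (hmin : IsGLB (distances V) dmin)
    (hmax : IsLUB (distances V) dmax) {S : List (Request V) → State V}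
    (hS : IsLocalSearch (Real.exp 2) S) :
    HasAmortizedRecourse (11 * (1 + Real.log (dmax / dmin))) (outputOf S) := by
  classical
  have hγ : (1 : ℝ) < Real.exp 2 := Real.one_lt_exp_iff.2 (by norm_num)
  have key : ∀ σ, Legal σ → (totalRecourse (outputOf S) σ : ℝ) + 10 * potential dmin (S σ) ≤
      11 * (1 + Real.log (dmax / dmin)) * σ.length := by
    intro σ
    induction σ with
    | nil =>
      intro _
      have h1 : (S []).tree = ∅ := by rw [hS.1]; simp [State.tree]
      simp [totalRecourse, outputOf, potential, h1]
    | cons r σ ih =>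
      intro h
      have h1 := ih h.of_cons
      have h2 := (hS.2 r σ h).recourse h0 hmin hmax (hS.invariant hγ σ h.of_cons).1
      have h3 : (totalRecourse (outputOf S) (r :: σ) : ℝ) = totalRecourse (outputOf S) σ +
          (symmDiff (S (r :: σ)).tree (S σ).tree).card := by
        simp [totalRecourse, outputOf]
      rw [h3, List.length_cons]
      push_cast
      linarith
  intro σ h
  have h1 := key σ h
  have h2 : 0 ≤ potential dmin (S σ) := Finset.sum_nonneg fun e he =>
    zero_le_one.trans (one_le_edgePotential h0 hmin
      ((hS.invariant hγ σ h).1.not_isDiag he))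
  linarith

end Recourse

/-! ## Terminal states of the local search -/

section Terminal

variable {V : Type*} [MetricSpace V] {γ : ℝ} {s : State V} {x y v : V}

/-- Used with the density: when no swap is possible, the permutation is sorted by decreasing
density. -/
theorem pairwise_of_adjacent {α : Type*} {ρ : α → ℝ} {l : List α}
    (h : ∀ X e u Y, l = X ++ e :: u :: Y → ρ u ≤ ρ e) : l.Pairwise fun e u => ρ u ≤ ρ e := by
  induction l with
  | nil => exact List.Pairwise.nil
  | cons a m ih =>
    have hm := ih fun X e u Y k => h (a :: X) e u Y (by rw [k]; rfl)
    refine List.pairwise_cons.2 ⟨fun b hb => ?_, hm⟩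
    cases m with
    | nil => simp at hb
    | cons c m =>
      have hca := h [] a c m rfl
      rcases List.mem_cons.1 hb with rfl | hb
      · exact hca
      · exact ((List.pairwise_cons.1 hm).1 b hb).trans hca

theorem exists_first {α : Type*} {p : α → Prop} {l : List α} (h : ∃ b ∈ l, p b) :
    ∃ X b Y, l = X ++ b :: Y ∧ p b ∧ ∀ x ∈ X, ¬ p x := by
  induction l with
  | nil => simp at h
  | cons a l ih =>
    by_cases ha : p a
    · exact ⟨[], a, l, rfl, ha, by simp⟩
    · obtain ⟨b, hb, hpb⟩ := h
      have hbl : b ∈ l := (List.mem_cons.1 hb).resolve_left fun k => ha (k ▸ hpb)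
      obtain ⟨X, c, Y, rfl, hc, hX⟩ := ih ⟨b, hbl, hpb⟩
      refine ⟨a :: X, c, Y, rfl, hc, fun x hx => ?_⟩
      rcases List.mem_cons.1 hx with rfl | hx
      exacts [ha, hX x hx]

/-- In a locally optimal state, live vertices are joined by edges of the solution that are
shorter than `γ` times their distance. -/
theorem State.WellFormed.joined_short (hγ : 1 < γ) (hs : s.WellFormed)
    (hopt : ¬ ∃ s', LocalMove γ s s') (hx : x ∈ s.live) (hy : y ∈ s.live) :
    Joined {e | e ∈ s.tree ∧ edgeCost e < γ * dist x y} x y := by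
  by_cases hxy : x = y
  · subst hxy; exact SimpleGraph.Reachable.refl _
  by_contra hcon
  have hd : 0 < dist x y := dist_pos.2 hxy
  obtain ⟨A, L, π⟩ := s
  have hup : s(x, y) ∈ π := by
    refine (hs.mem_perm _).2 ⟨by simpa using hxy, fun z hz => ?_⟩
    rcases Sym2.mem_iff.1 hz with rfl | rfl
    exacts [hx, hy]
  have hut : s(x, y) ∉ (State.mk A L π).tree := fun k =>
    hcon (joined_of_mem ⟨k, by rw [edgeCost_mk]; nlinarith⟩)
  obtain ⟨Z, Y, rfl, huZ⟩ := exists_eq_append_of_mem hup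
  -- A prefix of `Z` without long tree edges cannot span `s(x, y)`: its span comes from its greedy
  -- edges, all short, against `hcon`.
  have hspan : ∀ X X' : List (Sym2 V), Z = X ++ X' →
      (∀ e ∈ X, ¬ (e ∈ (State.mk A L (Z ++ s(x, y) :: Y)).tree ∧ γ * dist x y ≤ edgeCost e)) →
      ¬ Spanned {e | e ∈ X} s(x, y) := by
    intro X X' hZ hX h
    have h1 : Spanned (∅ ∪ {e | e ∈ X}) s(x, y) := by rwa [Set.empty_union]
    have h2 := h1.greedy
    rw [Set.empty_union, spanned_mk] at h2
    refine hcon (h2.mono fun e he => ?_)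
    have het : e ∈ (State.mk A L (Z ++ s(x, y) :: Y)).tree := by
      rw [hs.mem_tree]
      simp only [hZ, List.append_assoc]
      rw [greedy_append]
      exact List.mem_append_left _ he
    exact ⟨het, lt_of_not_ge fun k => hX e (mem_of_mem_greedy he).1 ⟨het, k⟩⟩
  by_cases hex : ∃ b ∈ Z, b ∈ (State.mk A L (Z ++ s(x, y) :: Y)).tree ∧
      γ * dist x y ≤ edgeCost b
  -- Take the block from the first long tree edge `b₀` up to `s(x, y)`. By sortedness `b₀` has the
  -- largest density in it, so `s(x, y)` could make a `γ`-move ahead of the block.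
  · obtain ⟨X, b₀, B, rfl, ⟨hb₀, hb₀'⟩, hX⟩ := exists_first hex
    have hnot := hspan X (b₀ :: B) rfl hX
    have hform : (X ++ b₀ :: B) ++ s(x, y) :: Y = X ++ ((b₀ :: B) ++ s(x, y) :: Y) := by simp
    rw [hform] at hs hopt hb₀ hut
    have hsort := pairwise_of_adjacent (ρ := density L (X ++ ((b₀ :: B) ++ s(x, y) :: Y)))
      (l := X ++ ((b₀ :: B) ++ s(x, y) :: Y)) (by
        intro X' e u Y' k
        by_contra hlt
        rw [k] at hopt hlt
        exact hopt ⟨_, LocalMove.swap A L X' Y' e u (lt_of_not_ge hlt)⟩)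
    have hs' := hs.of_perm (move_perm X (b₀ :: B) Y s(x, y))
    have huX : s(x, y) ∉ X := fun k => huZ (List.mem_append_left _ k)
    have hu' : s(x, y) ∈ (State.mk A L (X ++ s(x, y) :: ((b₀ :: B) ++ Y))).perm := by simp
    have hug : s(x, y) ∈ greedy ∅ (X ++ s(x, y) :: ((b₀ :: B) ++ Y)) := by
      refine mem_greedy.2 ⟨hu', ?_⟩
      rwa [preceding_append huX]
    have hdu := hs'.density_eq hu'
    rw [treeDensity, if_pos (hs'.mem_tree.2 hug)] at hdu
    refine hopt ⟨_, LocalMove.gammaMove A L X (b₀ :: B) Y s(x, y) (by simp)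
      ((density_pos_iff hs'.valid hu').2 hug) fun b hb => ?_⟩
    have hdb₀ := hs.density_eq (hs.mem_perm_of_mem_tree hb₀)
    rw [treeDensity, if_pos hb₀] at hdb₀
    have hle : density L (X ++ ((b₀ :: B) ++ s(x, y) :: Y)) b ≤
        density L (X ++ ((b₀ :: B) ++ s(x, y) :: Y)) b₀ := by
      rcases List.mem_cons.1 hb with rfl | hb
      · exact le_rfl
      · have := (List.pairwise_append.1 hsort).2.1
        exact (List.pairwise_cons.1 this).1 b (List.mem_append_left _ hb)
    have hb0 : 0 < edgeCost b₀ := edgeCost_pos (hs.not_isDiag hb₀)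
    simp only at hdu hdb₀
    rw [hdu]
    refine (mul_le_mul_of_nonneg_left hle (by linarith)).trans ?_
    rw [hdb₀, edgeCost_mk, ← div_eq_mul_inv, div_le_iff₀ hb0, ← div_eq_inv_mul, le_div_iff₀ hd]
    exact hb₀'
  · push Not at hex
    refine hspan Z [] (by simp) (fun e he k => absurd k.2 (not_le.2 (hex e he k.1))) ?_
    by_contra k
    refine hut (hs.mem_tree.2 (mem_greedy.2 ⟨hup, ?_⟩))
    rwa [preceding_append huZ]

open scoped Classical in
theorem State.WellFormed.three_le_degree (hs : s.WellFormed) (hc : ¬ ∃ s', CleanStep s s')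
    (hv : v ∈ s.live) (hv' : v ∉ s.active) : 3 ≤ (s.tree.filter (fun e => v ∈ e)).card := by
  by_contra hlt
  have hd : s.degree v = (s.tree.filter (fun e => v ∈ e)).card := rfl
  by_cases h1 : s.degree v ≤ 1
  · exact hc ⟨_, CleanStep.delete s v hv hv' h1⟩
  · have h2 : s.degree v = 2 := by omega
    have h3 := h2
    rw [hd, Finset.card_eq_two] at h3
    obtain ⟨e, f, hef, hfil⟩ := h3
    have he := Finset.mem_filter.1 (hfil ▸ Finset.mem_insert_self e {f})
    have hf := Finset.mem_filter.1
      (hfil ▸ Finset.mem_insert_of_mem (Finset.mem_singleton_self f) :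
        f ∈ s.tree.filter (fun e => v ∈ e))
    obtain ⟨u₁, rfl⟩ := Sym2.mem_iff_exists.1 he.2
    obtain ⟨u₂, rfl⟩ := Sym2.mem_iff_exists.1 hf.2
    obtain ⟨X, Y, hXY, -⟩ := exists_eq_append_of_mem (hs.mem_perm_of_mem_tree he.1)
    obtain ⟨A, L, π⟩ := s
    simp only at hXY
    subst hXY
    exact hc ⟨_, CleanStep.shortcut A L X Y v u₁ u₂ hv hv' (fun k => hef (by rw [k])) h2 he.1 hf.1⟩

end Terminal

/-! ## Counting in forests -/

section Forest

variable {V : Type*} {F : Finset (Sym2 V)} {W R : Finset V}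

/-- A forest on `W` has `|W| - |F|` components, and `R` meets each at most once. In the induction,
removing an edge splits a component, and an end point on a side without a member of `R` joins `R`.
-/
theorem Indep.card_add_card_le (hF : Indep (F : Set (Sym2 V)))
    (hW : Within W (F : Set (Sym2 V))) (hRW : R ⊆ W)
    (hR : ∀ a ∈ R, ∀ b ∈ R, Joined (F : Set (Sym2 V)) a b → a = b) :
    F.card + R.card ≤ W.card := by
  classical
  induction F using Finset.induction_on generalizing R with
  | empty => simpa using Finset.card_le_card hRW
  | insert e F he ih =>
    have hsub : (F : Set (Sym2 V)) ⊆ (insert e F : Finset _) :=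
      Finset.coe_subset.2 (Finset.subset_insert _ _)
    have hne : ¬ Spanned (F : Set (Sym2 V)) e := by
      have := hF e (by simp)
      rwa [Finset.coe_insert, Set.insert_sdiff_self_of_notMem (by simpa using he)] at this
    have hext : ∀ z, (∃ a ∈ R, ∃ w, e = s(w, z) ∧ Joined (F : Set (Sym2 V)) a w) ∨
        (∃ w, e = s(w, z) ∧ ∀ a ∈ R, ¬ Joined (F : Set (Sym2 V)) a z) →
        (insert e F).card + R.card ≤ W.card := by
      intro z hz
      have hz' : z ∈ W ∧ ∀ a ∈ R, ¬ Joined (F : Set (Sym2 V)) a z := by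
        rcases hz with ⟨a, ha, w, rfl, haw⟩ | ⟨w, rfl, h⟩
        · refine ⟨hW _ (Finset.mem_coe.2 (Finset.mem_insert_self _ _)) z (by simp),
            fun b hb hbz => ?_⟩
          rw [spanned_mk] at hne
          have hab : a = b := hR a ha b hb (by
            rw [Finset.coe_insert, joined_insert]
            exact Or.inr (Or.inl ⟨haw, hbz.symm⟩))
          subst hab
          exact hne (haw.symm.trans hbz)
        · exact ⟨hW _ (Finset.mem_coe.2 (Finset.mem_insert_self _ _)) z (by simp), h⟩
      have hzR : z ∉ R := fun k => hz'.2 z k (SimpleGraph.Reachable.refl _)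
      have := ih (R := insert z R) (hF.mono hsub) (hW.mono hsub)
        (Finset.insert_subset hz'.1 hRW) (by
          intro a ha b hb hab
          rcases Finset.mem_insert.1 ha with ha | ha <;>
            rcases Finset.mem_insert.1 hb with hb | hb
          · exact ha.trans hb.symm
          · exact absurd (ha ▸ hab.symm) (hz'.2 b hb)
          · exact absurd (hb ▸ hab) (hz'.2 a ha)
          · exact hR a ha b hb (hab.mono hsub))
      rw [Finset.card_insert_of_notMem hzR] at this
      rw [Finset.card_insert_of_notMem he]
      omega
    induction e with | h x y
    by_cases hx : ∃ a ∈ R, Joined (F : Set (Sym2 V)) a x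
    · obtain ⟨a, ha, hax⟩ := hx
      exact hext y (Or.inl ⟨a, ha, x, rfl, hax⟩)
    · push Not at hx
      exact hext x (Or.inr ⟨y, Sym2.eq_swap, hx⟩)

/-- The opposite count, valid for any edge set: removing an edge is made up for by adding one of its
end points to `R`. -/
theorem card_le_card_add_card (hR : ∀ w ∈ W, ∃ a ∈ R, Joined (F : Set (Sym2 V)) w a) :
    W.card ≤ F.card + R.card := by
  classical
  induction F using Finset.induction_on generalizing R with
  | empty =>
    simp only [Finset.coe_empty, joined_empty] at hR
    simpa using Finset.card_le_card fun w hw => by obtain ⟨a, ha, rfl⟩ := hR w hw; exact ha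
  | insert e F he ih =>
    have hext : ∀ z, (∀ w ∈ W, ∃ a ∈ insert z R, Joined (F : Set (Sym2 V)) w a) →
        W.card ≤ (insert e F).card + R.card := by
      intro z hz
      have h1 := ih hz
      have h2 := Finset.card_insert_le z R
      rw [Finset.card_insert_of_notMem he]
      omega
    induction e with | h x y
    simp only [Finset.coe_insert, joined_insert] at hR
    by_cases hx : ∃ a ∈ R, Joined (F : Set (Sym2 V)) a x
    · obtain ⟨a, ha, hax⟩ := hx
      refine hext y fun w hw => ?_
      obtain ⟨b, hb, h | ⟨h, -⟩ | ⟨h, -⟩⟩ := hR w hw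
      · exact ⟨b, Finset.mem_insert_of_mem hb, h⟩
      · exact ⟨a, Finset.mem_insert_of_mem ha, h.trans hax.symm⟩
      · exact ⟨y, Finset.mem_insert_self _ _, h⟩
    · refine hext x fun w hw => ?_
      obtain ⟨b, hb, h | ⟨h, -⟩ | ⟨-, h⟩⟩ := hR w hw
      · exact ⟨b, Finset.mem_insert_of_mem hb, h⟩
      · exact ⟨x, Finset.mem_insert_self _ _, h⟩
      · exact absurd ⟨b, hb, h.symm⟩ hx

/-- A set of pairwise inequivalent elements extends to a set of representatives. -/
theorem exists_transversal {r : V → V → Prop} (hr : Equivalence r) {P : Finset V} (A : Finset V)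
    (hP : ∀ a ∈ P, ∀ b ∈ P, r a b → a = b) :
    ∃ Q, P ⊆ Q ∧ (∀ a ∈ Q, a ∈ P ∨ a ∈ A) ∧ (∀ a ∈ Q, ∀ b ∈ Q, r a b → a = b) ∧
      ∀ a ∈ A, ∃ q ∈ Q, r a q := by
  classical
  induction A using Finset.induction_on with
  | empty => exact ⟨P, subset_rfl, fun a ha => Or.inl ha, hP, by simp⟩
  | insert a A _ ih =>
    obtain ⟨Q, h1, h2, h3, h4⟩ := ih
    by_cases ha : ∃ q ∈ Q, r a q
    · refine ⟨Q, h1, fun b hb => (h2 b hb).imp_right (Finset.mem_insert_of_mem), h3, ?_⟩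
      intro b hb
      rcases Finset.mem_insert.1 hb with rfl | hb
      exacts [ha, h4 b hb]
    · refine ⟨insert a Q, h1.trans (Finset.subset_insert _ _), ?_, ?_, ?_⟩
      · intro b hb
        rcases Finset.mem_insert.1 hb with rfl | hb
        · exact Or.inr (Finset.mem_insert_self _ _)
        · exact (h2 b hb).imp_right (Finset.mem_insert_of_mem)
      · intro b hb c hc hbc
        rcases Finset.mem_insert.1 hb with hb | hb <;> rcases Finset.mem_insert.1 hc with hc | hc
        · exact hb.trans hc.symm
        · exact absurd ⟨c, hc, hb ▸ hbc⟩ ha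
        · exact absurd ⟨b, hb, hr.symm (hc ▸ hbc)⟩ ha
        · exact h3 b hb c hc hbc
      · intro b hb
        rcases Finset.mem_insert.1 hb with rfl | hb
        · exact ⟨b, Finset.mem_insert_self _ _, hr.refl _⟩
        · obtain ⟨q, hq, h⟩ := h4 b hb
          exact ⟨q, Finset.mem_insert_of_mem hq, h⟩

open scoped Classical in
/-- In a tree all of whose Steiner vertices have degree at least three, the number of edges
outside a subforest is controlled by the number of its components that contain terminals. -/
theorem exists_separated_terminals {T Fs : Finset (Sym2 V)} {A L : Finset V}
    (hT : Indep (T : Set (Sym2 V))) (hTL : Within L (T : Set (Sym2 V)))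
    (hAL : A ⊆ L)
    (hdeg : ∀ v ∈ L, v ∉ A → 3 ≤ (T.filter (fun e => v ∈ e)).card) (hL : L.Nonempty)
    (hFs : Fs ⊆ T) :
    ∃ P ⊆ A, (∀ a ∈ P, ∀ b ∈ P, Joined (Fs : Set (Sym2 V)) a b → a = b) ∧
      (T \ Fs).card + 3 ≤ 3 * P.card := by
  obtain ⟨P, -, hPA, hP, hPcov⟩ := exists_transversal (joined_equivalence (Fs : Set (Sym2 V)))
    (P := ∅) A (by simp)
  replace hPA : P ⊆ A := fun a ha => (hPA a ha).resolve_left (Finset.notMem_empty _)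
  obtain ⟨R, hPR, hRL, hR, hRcov⟩ := exists_transversal
    (joined_equivalence (Fs : Set (Sym2 V))) L hP
  replace hRL : R ⊆ L := fun a ha => (hRL a ha).elim (fun k => hAL (hPA k)) id
  refine ⟨P, hPA, hP, ?_⟩
  have hFsT : (Fs : Set (Sym2 V)) ⊆ T := Finset.coe_subset.2 hFs
  have hcard : (T \ Fs).card + Fs.card = T.card := Finset.card_sdiff_add_card_eq_card hFs
  have hRcard : (R \ P).card + P.card = R.card := Finset.card_sdiff_add_card_eq_card hPR
  have h1 : L.card ≤ Fs.card + R.card := card_le_card_add_card hRcov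
  have h2 : T.card + 1 ≤ L.card := by
    obtain ⟨x, hx⟩ := hL
    have := hT.card_add_card_le hTL (R := {x}) (Finset.singleton_subset_iff.2 hx) (by
      intro a ha b hb _
      rw [Finset.mem_singleton.1 ha, Finset.mem_singleton.1 hb])
    simpa using this
  -- `P` represents the components of `Fs` with terminals, `Q` those without. `U` holds the vertices
  -- of the latter, all Steiner vertices, and `FU` their edges.
  set Q := R \ P with hQ
  set U := L.filter (fun v => ∃ q ∈ Q, Joined (Fs : Set (Sym2 V)) v q) with hU
  set FU := Fs.filter (fun e => ∃ x ∈ e, x ∈ U) with hFU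
  have hUA : ∀ v ∈ U, v ∉ A := by
    intro v hv hvA
    obtain ⟨-, q, hq, hvq⟩ := Finset.mem_filter.1 hv
    obtain ⟨p, hp, hvp⟩ := hPcov v hvA
    have hq' := Finset.mem_sdiff.1 hq
    have : p = q := hR p (hPR hp) q hq'.1 (hvp.symm.trans hvq)
    exact hq'.2 (this ▸ hp)
  have hUclosed : ∀ a b, s(a, b) ∈ Fs → a ∈ U → b ∈ U := by
    intro a b hab ha
    obtain ⟨-, q, hq, haq⟩ := Finset.mem_filter.1 ha
    exact Finset.mem_filter.2 ⟨hTL _ (hFsT hab) b (by simp), q, hq,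
      ((joined_of_mem (Finset.mem_coe.2 hab)).symm).trans haq⟩
  have hQU : Q ⊆ U := fun q hq => Finset.mem_filter.2
    ⟨hRL (Finset.mem_sdiff.1 hq).1, q, hq, SimpleGraph.Reachable.refl _⟩
  have hFUFs : (FU : Set (Sym2 V)) ⊆ Fs := Finset.coe_subset.2 (Finset.filter_subset _ _)
  have h3 : FU.card + Q.card ≤ U.card := by
    refine (hT.mono (hFUFs.trans hFsT)).card_add_card_le ?_ hQU ?_
    · intro e he x hx
      obtain ⟨heF, z, hz, hzU⟩ := Finset.mem_filter.1 (Finset.mem_coe.1 he)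
      obtain ⟨w, rfl⟩ := Sym2.mem_iff_exists.1 hz
      rcases Sym2.mem_iff.1 hx with rfl | rfl
      exacts [hzU, hUclosed _ _ heF hzU]
    · exact fun a ha b hb hab => hR a (Finset.mem_sdiff.1 ha).1 b (Finset.mem_sdiff.1 hb).1
        (hab.mono hFUFs)
  have h4 : 3 * U.card ≤ ∑ v ∈ U, (T.filter (fun e => v ∈ e)).card := by
    rw [mul_comm, ← smul_eq_mul]
    exact Finset.card_nsmul_le_sum _ _ _ fun v hv => hdeg v (Finset.mem_filter.1 hv).1 (hUA v hv)
  have h5 : ∑ v ∈ U, (T.filter (fun e => v ∈ e)).card =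
      ∑ e ∈ T, (U.filter (fun v => v ∈ e)).card :=
    Finset.sum_card_bipartiteAbove_eq_sum_card_bipartiteBelow (fun v e => v ∈ e)
  have h6 : ∑ e ∈ T, (U.filter (fun v => v ∈ e)).card ≤
      ∑ e ∈ T, if e ∈ FU ∪ T \ Fs then 2 else 0 := by
    refine Finset.sum_le_sum fun e he => ?_
    split_ifs with h
    · induction e with | h x y
      refine (Finset.card_le_card ?_).trans (Finset.card_le_two (a := x) (b := y))
      intro z hz
      simpa using (Finset.mem_filter.1 hz).2
    · rw [Finset.mem_union, Finset.mem_sdiff, not_or] at h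
      rw [Nat.le_zero, Finset.card_eq_zero, Finset.filter_eq_empty_iff]
      intro x hx hxe
      have heFs : e ∈ Fs := by
        by_contra k
        exact h.2 ⟨he, k⟩
      exact h.1 (Finset.mem_filter.2 ⟨heFs, x, hxe, hx⟩)
  have h7 : (∑ e ∈ T, if e ∈ FU ∪ T \ Fs then 2 else 0) ≤ 2 * (FU.card + (T \ Fs).card) := by
    rw [← Finset.sum_filter, Finset.sum_const, smul_eq_mul, mul_comm]
    refine Nat.mul_le_mul_left 2 ((Finset.card_le_card ?_).trans (Finset.card_union_le _ _))
    exact fun e he => (Finset.mem_filter.1 he).2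
  -- Put `m = |T \ Fs|`. Counting components gives `m ≤ |P| + |Q| - 1`. Degrees give `3|U| ≤ 2(|U| -
  -- |Q| + m)`, hence `3|Q| ≤ 2m` as `|Q| ≤ |U|`. Together `m + 3 ≤ 3|P|`.
  have h8 := Finset.card_le_card hQU
  omega

end Forest

/-! ## Tours -/

section Tour

variable {V : Type*} [MetricSpace V]

/-- The distances of consecutive vertices. -/
noncomputable def steps : List V → List ℝ
  | [] => []
  | [_] => []
  | a :: b :: l => dist a b :: steps (b :: l)

theorem steps_nonneg (l : List V) : ∀ d ∈ steps l, 0 ≤ d := by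
  induction l with
  | nil => simp [steps]
  | cons a l ih =>
    cases l with
    | nil => simp [steps]
    | cons b l =>
      intro d hd
      rcases List.mem_cons.1 hd with rfl | hd
      exacts [dist_nonneg, ih d hd]

theorem sum_steps_cons_le (a b : V) (l : List V) :
    (steps (a :: l)).sum ≤ (steps (a :: b :: l)).sum := by
  cases l with
  | nil => simp [steps]
  | cons c l =>
    simp only [steps, List.sum_cons]
    linarith [dist_triangle a b c]

theorem sum_steps_sublist {l l' : List V} (h : l'.Sublist l) :
    (steps l').sum ≤ (steps l).sum := by
  -- A common first vertex makes the induction work: skipping a vertex is then one triangle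
  -- inequality.
  have key : ∀ {l l' : List V}, l'.Sublist l → ∀ a, (steps (a :: l')).sum ≤
      (steps (a :: l)).sum := by
    intro l l' h
    induction h with
    | slnil => exact fun a => le_rfl
    | cons b _ ih => exact fun a => (ih a).trans (sum_steps_cons_le a b _)
    | cons_cons b _ ih =>
      intro a
      simp only [steps, List.sum_cons]
      linarith [ih b]
  induction h with
  | slnil => exact le_rfl
  | @cons l₁ l₂ b h ih =>
    refine ih.trans ?_
    cases l₂ with
    | nil => simp [steps]
    | cons c l =>
      simp only [steps, List.sum_cons]
      linarith [dist_nonneg (x := b) (y := c)]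
  | cons_cons b h _ => exact key h b

theorem sum_steps_detour (l₁ l₂ : List V) (x y : V) :
    (steps (l₁ ++ x :: y :: x :: l₂)).sum = (steps (l₁ ++ x :: l₂)).sum + 2 * dist x y := by
  induction l₁ with
  | nil =>
    simp only [List.nil_append, steps, List.sum_cons, dist_comm y x]
    ring
  | cons a l₁ ih =>
    cases l₁ with
    | nil =>
      simp only [List.nil_append, List.cons_append, steps, List.sum_cons] at ih ⊢
      linarith
    | cons b l₁ =>
      simp only [List.cons_append, steps, List.sum_cons] at ih ⊢
      linarith

theorem cost_mono {F E : Finset (Sym2 V)} (h : F ⊆ E) : cost F ≤ cost E :=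
  Finset.sum_le_sum_of_subset_of_nonneg h fun e _ _ => edgeCost_nonneg e

/-- The vertices that a connected set of edges joins to `a` can be visited by a tour of at most
twice the length. -/
theorem exists_tour (E : Finset (Sym2 V)) (a : V) :
    ∃ l : List V, (∀ x, Joined (E : Set (Sym2 V)) a x → x ∈ l) ∧ (steps l).sum ≤ 2 * cost E := by
  classical
  -- `F` is the set of edges already paid for. While some edge of `E` leaves the tour at `x` towards
  -- `y`, insert the detour `x, y, x` and add that edge to `F`.
  have key : ∀ n (F : Finset (Sym2 V)) (l : List V), (E \ F).card = n → F ⊆ E → a ∈ l →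
      (∀ e ∈ F, ∀ x ∈ e, x ∈ l) → (steps l).sum ≤ 2 * cost F →
      ∃ l' : List V, a ∈ l' ∧ (∀ x ∈ l', ∀ y, s(x, y) ∈ E → y ∈ l') ∧
        (steps l').sum ≤ 2 * cost E := by
    intro n
    induction n with
    | zero =>
      intro F l hn hFE ha hF hl
      have hEF : E ⊆ F := Finset.sdiff_eq_empty_iff_subset.1 (Finset.card_eq_zero.1 hn)
      exact ⟨l, ha, fun x _ y hxy => hF _ (hEF hxy) y (by simp),
        hl.trans (by linarith [cost_mono hFE])⟩
    | succ n ih =>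
      intro F l hn hFE ha hF hl
      by_cases hclosed : ∀ x ∈ l, ∀ y, s(x, y) ∈ E → y ∈ l
      · exact ⟨l, ha, hclosed, hl.trans (by linarith [cost_mono hFE])⟩
      · push Not at hclosed
        obtain ⟨x, hx, y, hxy, hy⟩ := hclosed
        have hxyF : s(x, y) ∉ F := fun k => hy (hF _ k y (by simp))
        obtain ⟨l₁, l₂, rfl⟩ := List.append_of_mem hx
        have hsub : ∀ z ∈ l₁ ++ x :: l₂, z ∈ l₁ ++ x :: y :: x :: l₂ := by
          intro z hz
          simp only [List.mem_append, List.mem_cons] at hz ⊢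
          tauto
        refine ih (insert s(x, y) F) (l₁ ++ x :: y :: x :: l₂) ?_
          (Finset.insert_subset hxy hFE) (hsub a ha) ?_ ?_
        · have h1 := Finset.card_sdiff_add_card_eq_card hFE
          have h2 := Finset.card_sdiff_add_card_eq_card (Finset.insert_subset hxy hFE)
          rw [Finset.card_insert_of_notMem hxyF] at h2
          omega
        · intro e he z hz
          rcases Finset.mem_insert.1 he with rfl | he
          · rcases Sym2.mem_iff.1 hz with rfl | rfl <;> simp
          · exact hsub z (hF e he z hz)
        · rw [sum_steps_detour, cost, Finset.sum_insert hxyF, edgeCost_mk]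
          unfold cost at hl
          linarith
  obtain ⟨l, ha, hl, hsum⟩ := key _ ∅ [a] rfl (Finset.empty_subset _) (by simp) (by simp)
    (by simp [steps, cost])
  refine ⟨l, fun x hx => ?_, hsum⟩
  have := Joined.lift (S := (E : Set (Sym2 V))) (r := fun u v => u ∈ l ↔ v ∈ l)
    ⟨fun _ => Iff.rfl, fun h => h.symm, fun h k => h.trans k⟩
    (fun u v huv => ⟨fun k => hl u k v huv, fun k => hl v k u (by rwa [Sym2.eq_swap])⟩) hx
  exact this.1 ha

/-- A tour that visits inequivalent vertices has many steps between classes. -/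
theorem card_le_countP_steps {r : V → V → Prop} (hr : Equivalence r) {p : ℝ → Prop}
    [DecidablePred p] {P : Finset V} {l : List V} (hP : ∀ a ∈ P, ∀ b ∈ P, r a b → a = b)
    (hPl : ∀ a ∈ P, ∃ b ∈ l, r a b) (hl : ∀ a ∈ l, ∀ b ∈ l, ¬ r a b → p (dist a b)) :
    P.card ≤ (steps l).countP (fun d => p d) + 1 := by
  classical
  induction l generalizing P with
  | nil =>
    have : P = ∅ := Finset.eq_empty_of_forall_notMem fun a ha => by simpa using hPl a ha
    simp [this]
  | cons a l ih =>
    have hone : (P.filter fun q => r q a).card ≤ 1 := by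
      refine Finset.card_le_one.2 fun b hb c hc => ?_
      obtain ⟨hb1, hb2⟩ := Finset.mem_filter.1 hb
      obtain ⟨hc1, hc2⟩ := Finset.mem_filter.1 hc
      exact hP b hb1 c hc1 (hr.trans hb2 (hr.symm hc2))
    have hsplit := Finset.card_filter_add_card_filter_not (s := P) (fun q => r q a)
    cases l with
    | nil =>
      have : P.filter (fun q => ¬ r q a) = ∅ := by
        refine Finset.filter_eq_empty_iff.2 fun b hb => ?_
        obtain ⟨c, hc, hbc⟩ := hPl b hb
        rw [List.mem_singleton.1 hc] at hbc
        exact not_not.2 hbc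
      rw [this] at hsplit
      simp only [Finset.card_empty] at hsplit
      omega
    | cons b l =>
      have hl' : ∀ c ∈ b :: l, ∀ d ∈ b :: l, ¬ r c d → p (dist c d) := fun c hc d hd =>
        hl c (List.mem_cons_of_mem _ hc) d (List.mem_cons_of_mem _ hd)
      rw [steps, List.countP_cons]
      -- If `a` and `b` are equivalent, `a` can be dropped. Otherwise their step pays for the at
      -- most one member of `P` equivalent to `a`; the `+ 1` pays for the last class.
      by_cases hab : r a b
      · have := ih (P := P) hP (by
          intro c hc
          obtain ⟨d, hd, hcd⟩ := hPl c hc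
          rcases List.mem_cons.1 hd with rfl | hd
          · exact ⟨b, List.mem_cons_self, hr.trans hcd hab⟩
          · exact ⟨d, hd, hcd⟩) hl'
        omega
      · have h1 := ih (P := P.filter fun q => ¬ r q a)
          (fun c hc d hd => hP c (Finset.mem_filter.1 hc).1 d (Finset.mem_filter.1 hd).1) (by
          intro c hc
          obtain ⟨hc1, hc2⟩ := Finset.mem_filter.1 hc
          obtain ⟨d, hd, hcd⟩ := hPl c hc1
          rcases List.mem_cons.1 hd with rfl | hd
          · exact absurd hcd hc2
          · exact ⟨d, hd, hcd⟩) hl'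
        have h2 : p (dist a b) := hl a (by simp) b (by simp) hab
        simp only [h2, decide_true, if_true]
        omega

/-- If a multiset has at most as many elements above each positive threshold as another one, then
its sum is at most that of the other one. -/
theorem sum_le_sum_of_countP_le {X Y : Multiset ℝ} (hY : ∀ y ∈ Y, 0 ≤ y)
    (h : ∀ r, 0 < r → X.countP (fun x => r ≤ x) ≤ Y.countP (fun y => r ≤ y)) :
    X.sum ≤ Y.sum := by
  classical
  induction X using Multiset.strongInductionOn generalizing Y with
  | _ X ih =>
    by_cases hX : ∀ x ∈ X, x ≤ 0
    · have h1 := Multiset.sum_le_card_nsmul X 0 hX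
      have h2 := Multiset.sum_nonneg hY
      simp only [smul_zero] at h1
      linarith
    · push Not at hX
      obtain ⟨x₀, hx₀, hx₀'⟩ := hX
      -- Match the largest `x` with some `y ≥ x` and erase both. Up to `x` both counts fall by one;
      -- beyond it none of `X` is left.
      obtain ⟨x, hx, hmax⟩ := Finset.exists_max_image X.toFinset id
        ⟨x₀, Multiset.mem_toFinset.2 hx₀⟩
      simp only [Multiset.mem_toFinset, id] at hx hmax
      have hxpos : 0 < x := hx₀'.trans_le (hmax x₀ hx₀)
      have h1 : 0 < Y.countP (fun y => x ≤ y) :=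
        (Multiset.countP_pos.2 ⟨x, hx, le_rfl⟩).trans_le (h x hxpos)
      obtain ⟨y, hy, hxy⟩ := Multiset.countP_pos.1 h1
      have h2 := ih (X.erase x) (Multiset.erase_lt.2 hx) (Y := Y.erase y)
        (fun z hz => hY z (Multiset.mem_of_mem_erase hz)) (by
          intro r hr
          by_cases hrx : r ≤ x
          · have h3 := h r hr
            rw [← Multiset.cons_erase hx, ← Multiset.cons_erase hy,
              Multiset.countP_cons_of_pos _ (show r ≤ x from hrx),
              Multiset.countP_cons_of_pos _ (show r ≤ y from hrx.trans hxy)] at h3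
            exact Nat.le_of_succ_le_succ h3
          · have : (X.erase x).countP (fun x => r ≤ x) = 0 :=
              Multiset.countP_eq_zero.2 fun z hz k =>
                hrx (k.trans (hmax z (Multiset.mem_of_mem_erase hz)))
            rw [this]
            exact Nat.zero_le _)
      rw [← Multiset.cons_erase hx, ← Multiset.cons_erase hy, Multiset.sum_cons,
        Multiset.sum_cons]
      linarith

end Tour

/-! ## Competitiveness -/

section Competitive

variable {V : Type*} [MetricSpace V] {γ : ℝ} {s : State V}

/-- The factor 6 is 3 from the degree count times 2 from the tour; `γ` comes from local optimality.
-/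
theorem State.WellFormed.cost_tree_le (hγ : 1 < γ) (hs : s.WellFormed)
    (hend : ¬ ∃ s', Step γ s s') {E : Finset (Sym2 V)} (hE : IsSteinerTree s.active E) :
    cost s.tree ≤ 6 * γ * cost E := by
  classical
  have hγ0 : 0 < γ := by linarith
  have hclean : ¬ ∃ s', CleanStep s s' := fun ⟨s', h⟩ => hend ⟨s', Or.inl h⟩
  have hopt : ¬ ∃ s', LocalMove γ s s' := fun ⟨s', h⟩ => hend ⟨s', Or.inr ⟨hclean, h⟩⟩
  have hsep : s.live.Nonempty → ∀ r : ℝ, ∃ P ⊆ s.active,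
      (∀ a ∈ P, ∀ b ∈ P, Joined ((s.tree.filter fun e => edgeCost e < r : Finset _) :
        Set (Sym2 V)) a b → a = b) ∧
      (s.tree \ s.tree.filter fun e => edgeCost e < r).card + 3 ≤ 3 * P.card := fun hL r =>
    exists_separated_terminals hs.indep hs.within hs.active_subset
      (fun v hv hv' => hs.three_le_degree hclean hv hv') hL
      (Finset.filter_subset _ _)
  have hcostE : 0 ≤ cost E := Finset.sum_nonneg fun e _ => edgeCost_nonneg e
  by_cases hL : s.live.Nonempty
  -- The summand 3 in the degree count forces `P` to be nonempty for any threshold.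
  · obtain ⟨a, ha⟩ : s.active.Nonempty := by
      obtain ⟨P, hPA, -, hP⟩ := hsep hL 0
      have : 0 < P.card := by omega
      exact (Finset.card_pos.1 this).mono hPA
    obtain ⟨l₀, hl₀, hsum₀⟩ := exists_tour E a
    -- Vertices of `E` need not be live, so the tour is shortcut to the terminals, where local
    -- optimality applies.
    set l := l₀.filter (fun v => v ∈ s.active) with hldef
    have hl : ∀ x, x ∈ l ↔ x ∈ s.active := by
      intro x
      rw [hldef, List.mem_filter, decide_eq_true_eq]
      exact ⟨fun k => k.2, fun k => ⟨hl₀ x (hE.2.2 a x (Or.inl ha) (Or.inl k)), k⟩⟩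
    have hsum : (steps l).sum ≤ 2 * cost E := (sum_steps_sublist List.filter_sublist).trans hsum₀
    have hdom := sum_le_sum_of_countP_le (X := s.tree.val.map edgeCost)
      (Y := 3 • ((steps l : Multiset ℝ).map fun d => γ * d)) (by
        intro y hy
        obtain ⟨d, hd, rfl⟩ := Multiset.mem_map.1 (Multiset.mem_of_mem_nsmul hy)
        exact mul_nonneg hγ0.le (steps_nonneg l d (Multiset.mem_coe.1 hd))) (by
        intro r _
        obtain ⟨P, hPA, hP, hcard⟩ := hsep hL r
        -- Terminals with `γ * dist x y < r` are joined by tree edges shorter than `r`, so a step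
        -- between components satisfies `p`.
        have h1 := card_le_countP_steps (joined_equivalence _) (p := fun d => r ≤ γ * d) (l := l)
          hP (fun x hx => ⟨x, (hl x).2 (hPA hx), SimpleGraph.Reachable.refl _⟩) (by
            intro x hx y hy hxy
            by_contra hlt
            refine hxy ((hs.joined_short hγ hopt (hs.active_subset ((hl x).1 hx))
              (hs.active_subset ((hl y).1 hy))).mono fun e he => ?_)
            exact Finset.mem_coe.2 (Finset.mem_filter.2 ⟨he.1, he.2.trans (not_le.1 hlt)⟩))
        have h2 : (s.tree.val.map edgeCost).countP (fun x => r ≤ x) =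
            (s.tree \ s.tree.filter fun e => edgeCost e < r).card := by
          rw [Multiset.countP_map, ← Finset.filter_val, Finset.card_val]
          congr 1
          ext e
          simp only [Finset.mem_filter, Finset.mem_sdiff, not_and, not_lt]
          tauto
        rw [h2, Multiset.countP_nsmul, Multiset.countP_map, ← Multiset.countP_eq_card_filter,
          Multiset.coe_countP]
        -- The `+ 3` of the degree count cancels three times the `+ 1` of the tour count.
        omega)
    rw [Multiset.sum_nsmul, Multiset.sum_map_mul_left, Multiset.map_id', Multiset.sum_coe] at hdom
    have h3 : cost s.tree = (s.tree.val.map edgeCost).sum := rfl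
    rw [h3]
    simp only [nsmul_eq_mul, Nat.cast_ofNat] at hdom
    nlinarith
  · have h1 : s.tree = ∅ := by
      refine Finset.eq_empty_of_forall_notMem fun e he => hL ?_
      induction e with | h x y
      exact ⟨x, hs.within _ he x (by simp)⟩
    rw [h1, cost, Finset.sum_empty]
    positivity

theorem IsLocalSearch.isCompetitive (hγ : 1 < γ) {S : List (Request V) → State V}
    (hS : IsLocalSearch γ S) : IsCompetitive (6 * γ) (outputOf S) := by
  intro σ h E hE
  obtain ⟨h1, h2⟩ := hS.invariant hγ σ h
  cases σ with
  | nil =>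
    have h3 : outputOf S [] = ∅ := by
      simp [outputOf, hS.1, State.tree]
    have hcostE : 0 ≤ cost E := Finset.sum_nonneg fun e _ => edgeCost_nonneg e
    rw [h3, cost, Finset.sum_empty]
    have : 0 < γ := by linarith
    positivity
  | cons r σ =>
    obtain ⟨-, -, -, hend⟩ := hS.2 r σ h
    exact h1.cost_tree_le hγ hend (by rwa [h2])

end Competitive

end DynSteiner

theorem theoremD1 :
    ∃ κ K : ℝ, 0 < κ ∧ 0 < K ∧
      ∀ (V : Type*) [MetricSpace V] (dmin dmax : ℝ),
        IsGLB (DynSteiner.distances V) dmin → 0 < dmin → IsLUB (DynSteiner.distances V) dmax →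
        (∃ S : List (DynSteiner.Request V) → DynSteiner.State V,
          DynSteiner.IsLocalSearch (Real.exp 2) S) ∧
        ∀ S : List (DynSteiner.Request V) → DynSteiner.State V,
          DynSteiner.IsLocalSearch (Real.exp 2) S →
          DynSteiner.AlwaysTerminates (Real.exp 2) S ∧
          DynSteiner.IsFeasible (DynSteiner.outputOf S) ∧
          DynSteiner.IsCompetitive κ (DynSteiner.outputOf S) ∧
          DynSteiner.HasAmortizedRecourse (K * (1 + Real.log (dmax / dmin)))
            (DynSteiner.outputOf S) := by
  have hγ : (1 : ℝ) < Real.exp 2 := Real.one_lt_exp_iff.2 (by norm_num)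
  refine ⟨6 * Real.exp 2, 11, by positivity, by norm_num, ?_⟩
  intro V _ dmin dmax hmin h0 hmax
  exact ⟨⟨_, DynSteiner.isLocalSearch_search hγ⟩, fun S hS =>
    ⟨hS.alwaysTerminates hγ, hS.isFeasible hγ, hS.isCompetitive hγ,
      hS.hasAmortizedRecourse h0 hmin hmax⟩⟩
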